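/- **Setting.** Let $\Omega\subset\mathbb R^3$ be a Lipschitz domain whose complement $\Omega^c$ is compact, non-empty and contained in the open ball $B_{r_1^*}$ of radius $r_1^*>0$ about the origin. Let $\tilde\alpha\colon[0,\infty)\to[0,\infty)$ be continuous and non-decreasing, $\tilde\alpha=0$ on $[0,r_1^*]$, $\tilde\alpha>0$ on $(r_1^*,\infty)$, and $\tilde\alpha\in C^2((r_1^*,\infty))$ such that $\tilde\alpha,\tilde\alpha',\tilde\alpha''$ extend continuously to $[r_1^*,\infty)$. Put $\tilde d=1+i\tilde\alpha$, $\alpha(r)=r\tilde\alpha'(r)+\tilde\alpha(r)$, $d=1+i\alpha$, $d_0=\lim_{r\to\infty}\tilde d(r)/|\tilde d(r)|$, and $\hat d=1+i\hat\alpha$ with $\hat\alpha=\alpha$ on $(r_1^*,\infty)$ and $\hat\alpha=\lim_{\rho\to r_1^*+}\alpha(\rho)$ on $[0,r_1^*]$. Assume that $\frac{\tilde d|d|}{|\tilde d|d}\to1$, $(\tilde d/|\tilde d|)'\to0$ and $(d/|d|)'\to0$ as $r\to\infty$. Let $r_2^*>r_1^*$ and let $r_e\colon(0,r_2^*)\to(0,\infty)$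 be bijective and continuous with $r_e(r)=r$ for $r\le r_1^*$, and $r_e|_{(r_1^*,r_2^*)}$ continuously differentiable with non-vanishing derivative. Write $f_e=f\circ r_e$ for $f=\tilde d,d,\hat d$, $\gamma_e=r_e'$, $\tilde\gamma_e(r)=r_e(r)/r$, $f(x)=f(|x|)$ for radial functions, $P_x=|x|^{-2}xx^\top$ and $\Omega_e=\Omega\cap B_{r_2^*}$. Let $X_e$ be the space of all $u\in H^1_{\mathrm{loc}}(\Omega_e)$ with $u|_{\partial\Omega}=0$ and $\langle u,u\rangle_{X_e}<\infty$, where $$\langle u,u'\rangle_{X_e}=\Big\langle\big(\tilde\gamma_e^2\gamma_e^{-1}|\tilde d_e^2d_e^{-1}|P_x+\gamma_e|d_e|(I-P_x)\big)\nabla u,\nabla u'\Big\rangle_{L^2(\Omega_e)}+\big\langle\tilde\gamma_e^2\gamma_e|\tilde d_e^2d_e|\,u,u'\big\rangle_{L^2(\Omega_e)} .$$ **Galerkin spaces.** Let $X_e^{h(n)}\subset X_e$, $n\in\mathbb N$, be finite dimensional subspaces such that the orthogonal projections onto them converge point-wise to the identity on $X_e$. Let $h(n)>0$, $h(n)\to0$,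 and let $\Pi^e_{h(n)}\colon X_e\to X_e^{h(n)}$ be bounded linear projections which act locally, i.e. there are constants $C_1,R^*>1$ such that for all $n$ and all $x_0\in\Omega_e$: 1. if $B_{R^*h(n)}(x_0)\subset\Omega_e$, $s\in\{1,2\}$, $u\in X_e$ and $u|_{B_{R^*h(n)}(x_0)}\in H^s$, then $\|u-\Pi^e_{h(n)}u\|_{H^1(B_{h(n)}(x_0))}\le C_1h(n)^{s-1}\|u\|_{H^s(B_{R^*h(n)}(x_0))}$; 2. if $u\in X_e$ vanishes a.e. on $B_{R^*h(n)}(x_0)\cap\Omega_e$, then $\Pi^e_{h(n)}u$ vanishes a.e. on $B_{h(n)}(x_0)\cap\Omega_e$ (also when these balls meet the boundary of $\Omega_e$). Assume moreover that for every compact $D\subset\Omega_e$ there is $n_0$ such that for each $n>n_0$ some $u_{D,n}\in X_e^{h(n)}$ satisfies $u_{D,n}|_D=1$. **The operator.** For $\omega\in\mathbb C\setminus\{0\}$ let, with $\arg$ taking values in $[-\pi,\pi)$, $$\eta_e=\overline{\frac{|\hat d_e|}{\hat d_e}}\ \text{ if }\arg(-\omega^2d_0^2)\in[-\pi,0),\qquad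 \eta_e=\overline{\frac{\hat d_e}{\tilde d_e^2}\frac{|\tilde d_e|^2}{|\hat d_e|}}\ \text{ if }\arg(-\omega^2d_0^2)\in[0,\pi).$$ For $\epsilon>0$ let $\eta_{e,\epsilon}$ be any function on $[0,r_2^*)$, $C^\infty$ on $(r_1^*,r_2^*)$, with $\|\eta_e-\eta_{e,\epsilon}\|_{L^\infty(r_1^*,r_2^*)}<\epsilon$ for which there are $\hat r_1,\hat r_2\in(r_1^*,r_2^*)$ with $\eta_{e,\epsilon}=\eta_e(r_1^*)$ on $[0,\hat r_1]$ and $\eta_{e,\epsilon}=\lim_{r\to r_2^*-}\eta_e(r)$ on $[\hat r_2,r_2^*)$. Let $T_{e,\epsilon}(\omega)u=\eta_{e,\epsilon}(|\cdot|)\,u$. **Theorem.** For every $\omega\in\mathbb C\setminus\{0\}$ and every $\epsilon>0$ (in particular for any choice $\epsilon=\epsilon_0(\omega)$): $T_{e,\epsilon}(\omega)$ is a bounded operator on $X_e$; for every $n$ the operator $T^{h(n)}_{e,\epsilon}(\omega)=\Pi^e_{h(n)}T_{e,\epsilon}(\omega)|_{X_e^{h(n)}}$ on $X_e^{h(n)}$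 is Fredholm of index zero; and $$\lim_{n\to\infty}\ \sup_{u_n\in X_e^{h(n)}\setminus\{0\}}\frac{\|(T_{e,\epsilon}(\omega)-T^{h(n)}_{e,\epsilon}(\omega))u_n\|_{X_e}}{\|u_n\|_{X_e}}=0 .$$ -/

import Mathlib

open MeasureTheory Filter Topology Set
open scoped ENNReal

noncomputable section

namespace ExactPML

/-- Physical space `ℝ³` with its Euclidean norm. -/
abbrev E3 : Type := EuclideanSpace ℝ (Fin 3)

/-- Complex vectors, the values of gradients of complex functions. -/
abbrev C3 : Type := EuclideanSpace ℂ (Fin 3)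

/-! ### Domains -/

/-- A Lipschitz domain in `ℝ³`: an open connected set which near each of its boundary points is, in
rotated Cartesian coordinates, the set of points above the graph of a Lipschitz function. -/
structure IsLipschitzDomain (D : Set E3) : Prop where
  isOpen : IsOpen D
  isConnected : IsConnected D
  lipschitz_boundary : ∀ x ∈ frontier D, ∃ (L : E3 ≃ₗᵢ[ℝ] E3) (ρ : ℝ) (K : NNReal)
    (f : EuclideanSpace ℝ (Fin 2) → ℝ), 0 < ρ ∧ LipschitzWith K f ∧
      ∀ y ∈ Metric.ball x ρ, y ∈ D ↔ f !₂[L y 0, L y 1] < L y 2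

/-! ### Weak derivatives and Sobolev norms -/

/-- `g` is the weak (distributional) gradient of `u` in the open set `D`. -/
structure HasWeakGradient (D : Set E3) (u : E3 → ℂ) (g : E3 → C3) : Prop where
  locInt_fun : LocallyIntegrableOn u D volume
  locInt_grad : LocallyIntegrableOn g D volume
  integral_eq : ∀ φ : E3 → ℝ, ContDiff ℝ (⊤ : ℕ∞) φ → HasCompactSupport φ → tsupport φ ⊆ D →
    ∀ i : Fin 3, ∫ x in D, (fderiv ℝ φ x (EuclideanSpace.single i 1)) • u x =
      - ∫ x in D, φ x • g x i

/-- The square of the `H^k(D)` norm, i.e. the sum of the squared `L²(D)` norms of all iterated weak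
partial derivatives of order at most `k`. It is `⊤` if `u` is not in `H^k(D)`; weak gradients being
unique almost everywhere, the infimum is over at most one value. -/
def sobolevSq (D : Set E3) : ℕ → (E3 → ℂ) → ℝ≥0∞
  | 0, u => ∫⁻ x in D, ‖u x‖ₑ ^ 2
  | k + 1, u => (∫⁻ x in D, ‖u x‖ₑ ^ 2) +
      ⨅ (g : E3 → C3) (_ : HasWeakGradient D u g), ∑ i : Fin 3, sobolevSq D k (fun x => g x i)

/-- The `H^k(D)` norm for `k ≥ 1`, with value `⊤` for functions outside of `H^k(D)`. -/
def sobolevNorm (D : Set E3) (k : ℕ) (u : E3 → ℂ) : ℝ≥0∞ := sobolevSq D k u ^ (1 / 2 : ℝ)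

/-- `u|_D ∈ H^k(D)` for `k ≥ 1`. -/
def MemSobolev (D : Set E3) (k : ℕ) (u : E3 → ℂ) : Prop := sobolevSq D k u < ⊤

/-- The classical gradient of a differentiable complex function on `ℝ³`. -/
def classicalGradient (φ : E3 → ℂ) (x : E3) : C3 :=
  WithLp.toLp 2 fun i => fderiv ℝ φ x (EuclideanSpace.single i 1)

/-! ### Complex scaling quantities -/

/-- `d̃(r) = 1 + i α̃(r)`. -/
def dTilde (tα : ℝ → ℝ) (r : ℝ) : ℂ := 1 + Complex.I * (tα r : ℂ)

/-- `α(r) = r α̃'(r) + α̃(r)`. -/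
def alpha (tα : ℝ → ℝ) (r : ℝ) : ℝ := r * deriv tα r + tα r

/-- `d(r) = 1 + i α(r)`. -/
def dFun (tα : ℝ → ℝ) (r : ℝ) : ℂ := 1 + Complex.I * (alpha tα r : ℂ)

/-- `d₀ = lim_{r → ∞} d̃(r) / |d̃(r)|`. -/
def dZero (tα : ℝ → ℝ) : ℂ := limUnder atTop fun r => dTilde tα r / (‖dTilde tα r‖ : ℂ)

open Classical in
/-- `α̂(r) = α(r)` for `r > r₁`, continued constantly by `lim_{ρ → r₁+} α(ρ)` to `r ≤ r₁`. -/
def alphaHat (r₁ : ℝ) (tα : ℝ → ℝ) (r : ℝ) : ℝ :=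
  if r ≤ r₁ then limUnder (𝓝[>] r₁) (alpha tα) else alpha tα r

/-- `d̂(r) = 1 + i α̂(r)`. -/
def dHat (r₁ : ℝ) (tα : ℝ → ℝ) (r : ℝ) : ℂ := 1 + Complex.I * (alphaHat r₁ tα r : ℂ)

/-- The argument with values in `[-π, π)`. -/
def argNeg (z : ℂ) : ℝ := if z.arg = Real.pi then -Real.pi else z.arg

/-- The basic assumptions on the profile `α̃ : [0, ∞) → [0, ∞)` and the radius `r₁`. -/
structure IsProfile (r₁ : ℝ) (tα : ℝ → ℝ) : Prop where
  nonneg : ∀ r, 0 ≤ r → 0 ≤ tα r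
  eq_zero : ∀ r, 0 ≤ r → r ≤ r₁ → tα r = 0
  continuousOn : ContinuousOn tα (Ici 0)
  pos : ∀ r, r₁ < r → 0 < tα r
  monotoneOn : MonotoneOn tα (Ici 0)
  contDiffOn : ContDiffOn ℝ 2 tα (Ioi r₁)
  deriv_limit : ∃ l, Tendsto (deriv tα) (𝓝[>] r₁) (𝓝 l)
  deriv2_limit : ∃ l, Tendsto (deriv (deriv tα)) (𝓝[>] r₁) (𝓝 l)

/-- The additional asymptotic assumptions on the profile. -/
structure IsAsymptoticProfile (tα : ℝ → ℝ) : Prop where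
  ratio : Tendsto (fun r => dTilde tα r * (‖dFun tα r‖ : ℂ) / ((‖dTilde tα r‖ : ℂ) * dFun tα r))
    atTop (𝓝 1)
  deriv_dTilde : Tendsto (deriv fun r => dTilde tα r / (‖dTilde tα r‖ : ℂ)) atTop (𝓝 0)
  deriv_dFun : Tendsto (deriv fun r => dFun tα r / (‖dFun tα r‖ : ℂ)) atTop (𝓝 0)

/-- The real radial domain transformation `r_e : (0, r₂) → (0, ∞)`. The derivative on `(r₁, r₂)` does
not vanish, so that the Jacobian of `x ↦ r_e(|x|) x / |x|` is invertible. -/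
structure IsDomainTransformation (r₁ r₂ : ℝ) (re : ℝ → ℝ) : Prop where
  lt : r₁ < r₂
  bijOn : BijOn re (Ioo 0 r₂) (Ioi 0)
  continuousOn : ContinuousOn re (Ioo 0 r₂)
  contDiffOn : ContDiffOn ℝ 1 re (Ioo r₁ r₂)
  deriv_ne_zero : ∀ r ∈ Ioo r₁ r₂, deriv re r ≠ 0
  eq_self : ∀ r, 0 < r → r ≤ r₁ → re r = r

/-- The data of the truncationless formulation: the exterior domain `Ω`, the radii `r₁ < r₂`, the
profile `α̃` and the radial transformation `r_e`. -/
structure Data : Type where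
  Ω : Set E3
  r₁ : ℝ
  r₂ : ℝ
  tα : ℝ → ℝ
  re : ℝ → ℝ

/-- `Ω` is a Lipschitz domain with compact non-empty complement contained in the ball `B_{r₁}`. -/
structure IsExteriorDomain (Ω : Set E3) (r₁ : ℝ) : Prop where
  isLipschitzDomain : IsLipschitzDomain Ω
  isCompact_compl : IsCompact Ωᶜ
  nonempty_compl : Ωᶜ.Nonempty
  compl_subset : Ωᶜ ⊆ Metric.ball 0 r₁

namespace Data

variable (S : Data)

/-- The bounded domain `Ω_e = Ω ∩ B_{r₂}`. -/
def Ωe : Set E3 := S.Ω ∩ Metric.ball 0 S.r₂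

/-- `γ_e(r) = r_e'(r)`. -/
def γe (r : ℝ) : ℝ := deriv S.re r

/-- `γ̃_e(r) = r_e(r) / r`. -/
def γeTilde (r : ℝ) : ℝ := S.re r / r

/-- `d̃_e = d̃ ∘ r_e`. -/
def deTilde (r : ℝ) : ℂ := dTilde S.tα (S.re r)

/-- `d_e = d ∘ r_e`. -/
def de (r : ℝ) : ℂ := dFun S.tα (S.re r)

/-- `d̂_e = d̂ ∘ r_e`. -/
def deHat (r : ℝ) : ℂ := dHat S.r₁ S.tα (S.re r)

/-- The weight `γ̃_e² γ_e⁻¹ |d̃_e² d_e⁻¹|` of the radial part of the gradient. -/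
def weightRad (x : E3) : ℝ :=
  S.γeTilde ‖x‖ ^ 2 * (S.γe ‖x‖)⁻¹ * ‖S.deTilde ‖x‖ ^ 2 * (S.de ‖x‖)⁻¹‖

/-- The weight `γ_e |d_e|` of the tangential part of the gradient. -/
def weightTan (x : E3) : ℝ := S.γe ‖x‖ * ‖S.de ‖x‖‖

/-- The weight `γ̃_e² γ_e |d̃_e² d_e|` of the function itself. -/
def weightFun (x : E3) : ℝ :=
  S.γeTilde ‖x‖ ^ 2 * S.γe ‖x‖ * ‖S.deTilde ‖x‖ ^ 2 * S.de ‖x‖‖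

/-- The measure with density `w` on `Ω_e`. -/
def weighted (w : E3 → ℝ) : Measure E3 :=
  (volume.restrict S.Ωe).withDensity fun x => ENNReal.ofReal (w x)

end Data

/-- The orthogonal projection `P_x = |x|⁻² x xᵀ` onto the radial direction. -/
def Px (x : E3) : Matrix (Fin 3) (Fin 3) ℂ :=
  Matrix.of fun i j => (((‖x‖ ^ 2)⁻¹ * (x i * x j) : ℝ) : ℂ)

/-- `P_x v`. -/
def radialPart (x : E3) : C3 →ₗ[ℂ] C3 := Matrix.toEuclideanLin (Px x)

/-- `(I - P_x) v`. -/
def tangentialPart (x : E3) : C3 →ₗ[ℂ] C3 := Matrix.toEuclideanLin (1 - Px x)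

namespace Data

variable (S : Data)

/-- `u ∈ H¹_loc(Ω_e)` with gradient `g` and `u = 0` at `∂Ω`. As `∂Ω` lies in the ball `B_{r₁}`, the
boundary condition is that `u|_{Ω_e ∩ B_{r₁}}` is a limit in `H¹(Ω_e ∩ B_{r₁})` of functions from
`C_c^∞(Ω)`. -/
structure IsAdmissible (u : E3 → ℂ) (g : E3 → C3) : Prop where
  weakGradient : HasWeakGradient S.Ωe u g
  locL2_fun : ∀ K ⊆ S.Ωe, IsCompact K → MemLp u 2 (volume.restrict K)
  locL2_grad : ∀ K ⊆ S.Ωe, IsCompact K → MemLp g 2 (volume.restrict K)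
  zero_trace : ∃ φ : ℕ → E3 → ℂ,
    (∀ k, ContDiff ℝ (⊤ : ℕ∞) (φ k) ∧ HasCompactSupport (φ k) ∧ tsupport (φ k) ⊆ S.Ω) ∧
    Tendsto (fun k => eLpNorm (u - φ k) 2 (volume.restrict (S.Ωe ∩ Metric.ball 0 S.r₁)))
      atTop (𝓝 0) ∧
    Tendsto (fun k => eLpNorm (g - classicalGradient (φ k)) 2
      (volume.restrict (S.Ωe ∩ Metric.ball 0 S.r₁))) atTop (𝓝 0)

/-- The Hilbert sum of the weighted `L²(Ω_e)` spaces of functions, radial and tangential vector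
fields. -/
abbrev Ambient : Type :=
  WithLp 2 (Lp ℂ 2 (S.weighted S.weightFun) ×
    WithLp 2 (Lp C3 2 (S.weighted S.weightRad) × Lp C3 2 (S.weighted S.weightTan)))

end Data

theorem integrable_testFunction_smul {F : Type*} [NormedAddCommGroup F] [NormedSpace ℝ F]
    {D : Set E3} {f : E3 → F} (hf : LocallyIntegrableOn f D volume) {ψ : E3 → ℝ}
    (hc : Continuous ψ) (hs : HasCompactSupport ψ) (hsub : tsupport ψ ⊆ D) :
    Integrable (fun x => ψ x • f x) (volume.restrict D) := by
  have hK : IntegrableOn f (tsupport ψ) volume := hf.integrableOn_compact_subset hsub hs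
  have h1 : IntegrableOn (fun x => ψ x • f x) (tsupport ψ) volume :=
    hK.continuousOn_smul hc.continuousOn hs
  refine Integrable.restrict ?_
  refine (integrableOn_iff_integrable_of_support_subset ?_).1 h1
  intro x hx
  apply subset_tsupport
  intro h0
  apply hx
  simp [h0]

theorem tsupport_partial_subset {φ : E3 → ℝ} (i : Fin 3) :
    tsupport (fun x => fderiv ℝ φ x (EuclideanSpace.single i 1)) ⊆ tsupport φ :=
  tsupport_fderiv_apply_subset ℝ _

theorem HasWeakGradient.add {D : Set E3} {u v : E3 → ℂ} {g k : E3 → C3}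
    (hu : HasWeakGradient D u g) (hv : HasWeakGradient D v k) :
    HasWeakGradient D (u + v) (g + k) where
  locInt_fun := hu.locInt_fun.add hv.locInt_fun
  locInt_grad := hu.locInt_grad.add hv.locInt_grad
  integral_eq := by
    intro φ h1 h2 h3 i
    have hc : Continuous fun x => fderiv ℝ φ x (EuclideanSpace.single i 1) :=
      (h1.continuous_fderiv (by simp)).clm_apply continuous_const
    have hs : HasCompactSupport fun x => fderiv ℝ φ x (EuclideanSpace.single i 1) :=
      h2.mono' ((subset_tsupport _).trans (tsupport_partial_subset i))
    have ht := (tsupport_partial_subset (φ := φ) i).trans h3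
    have hp : ∀ {w : E3 → C3}, LocallyIntegrableOn w D volume →
        Integrable (fun x => φ x • w x i) (volume.restrict D) := by
      intro w hw
      have := integrable_testFunction_smul hw h1.continuous h2 h3
      exact (EuclideanSpace.proj i : C3 →L[ℂ] ℂ).integrable_comp this
    simp only [Pi.add_apply, PiLp.add_apply, smul_add]
    rw [integral_add (integrable_testFunction_smul hu.locInt_fun hc hs ht)
      (integrable_testFunction_smul hv.locInt_fun hc hs ht),
      integral_add (hp hu.locInt_grad) (hp hv.locInt_grad),
      hu.integral_eq φ h1 h2 h3 i, hv.integral_eq φ h1 h2 h3 i, neg_add]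

theorem HasWeakGradient.smul {D : Set E3} {u : E3 → ℂ} {g : E3 → C3} (c : ℂ)
    (hu : HasWeakGradient D u g) : HasWeakGradient D (c • u) (c • g) where
  locInt_fun := hu.locInt_fun.smul c
  locInt_grad := hu.locInt_grad.smul c
  integral_eq := by
    intro φ h1 h2 h3 i
    simp only [Pi.smul_apply, PiLp.smul_apply]
    simp_rw [smul_comm _ c]
    rw [integral_smul, integral_smul, hu.integral_eq φ h1 h2 h3 i, smul_neg]

theorem HasWeakGradient.zero {D : Set E3} : HasWeakGradient D 0 0 where
  locInt_fun := locallyIntegrableOn_zero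
  locInt_grad := locallyIntegrableOn_zero
  integral_eq := by intros; simp

theorem classicalGradient_add {φ ψ : E3 → ℂ} (h1 : ContDiff ℝ (⊤ : ℕ∞) φ) (h2 : ContDiff ℝ (⊤ : ℕ∞) ψ) :
    classicalGradient (φ + ψ) = classicalGradient φ + classicalGradient ψ := by
  ext x i
  simp [classicalGradient, fderiv_add (h1.differentiable (by simp) x)
    (h2.differentiable (by simp) x)]

theorem classicalGradient_smul {φ : E3 → ℂ} (c : ℂ) (h1 : ContDiff ℝ (⊤ : ℕ∞) φ) :
    classicalGradient (c • φ) = c • classicalGradient φ := by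
  ext x i
  simp [classicalGradient, fderiv_const_smul (h1.differentiable (by simp) x)]

theorem tendsto_eLpNorm_add {F : Type*} [NormedAddCommGroup F] {μ : Measure E3}
    {a b : E3 → F} {p q : ℕ → E3 → F} (ha : ∀ n, AEStronglyMeasurable (a - p n) μ)
    (hb : ∀ n, AEStronglyMeasurable (b - q n) μ)
    (h1 : Tendsto (fun n => eLpNorm (a - p n) 2 μ) atTop (𝓝 0))
    (h2 : Tendsto (fun n => eLpNorm (b - q n) 2 μ) atTop (𝓝 0)) :
    Tendsto (fun n => eLpNorm (a + b - (p n + q n)) 2 μ) atTop (𝓝 0) := by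
  refine tendsto_of_tendsto_of_tendsto_of_le_of_le tendsto_const_nhds
    (by simpa using h1.add h2) (fun _ => zero_le) fun n => ?_
  simp only []
  rw [add_sub_add_comm]
  exact eLpNorm_add_le (ha n) (hb n) (by norm_num)

theorem tendsto_eLpNorm_smul {F : Type*} [NormedAddCommGroup F] [NormedSpace ℂ F]
    {μ : Measure E3} {a : E3 → F} {p : ℕ → E3 → F} (c : ℂ)
    (h1 : Tendsto (fun n => eLpNorm (a - p n) 2 μ) atTop (𝓝 0)) :
    Tendsto (fun n => eLpNorm (c • a - c • p n) 2 μ) atTop (𝓝 0) := by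
  simp_rw [← smul_sub, eLpNorm_const_smul]
  simpa using ENNReal.Tendsto.const_mul h1 (Or.inr enorm_ne_top)

theorem continuous_classicalGradient {φ : E3 → ℂ} (h1 : ContDiff ℝ (⊤ : ℕ∞) φ) :
    Continuous (classicalGradient φ) := by
  unfold classicalGradient
  refine (PiLp.continuous_toLp 2 _).comp (continuous_pi fun i => ?_)
  exact (h1.continuous_fderiv (by simp)).clm_apply continuous_const

namespace Data

variable {S : Data}

theorem IsAdmissible.aesm {F : Type*} [NormedAddCommGroup F] {f p : E3 → F} {A : Set E3}
    (hf : LocallyIntegrableOn f S.Ωe volume) (hp : Continuous p) [SecondCountableTopology F] :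
    AEStronglyMeasurable (f - p) (volume.restrict (S.Ωe ∩ A)) :=
  (hf.aestronglyMeasurable.mono_measure
    (Measure.restrict_mono inter_subset_left le_rfl)).sub hp.aestronglyMeasurable

theorem IsAdmissible.add {u v : E3 → ℂ} {g k : E3 → C3} (hu : S.IsAdmissible u g)
    (hv : S.IsAdmissible v k) : S.IsAdmissible (u + v) (g + k) where
  weakGradient := hu.weakGradient.add hv.weakGradient
  locL2_fun := fun K h1 h2 => (hu.locL2_fun K h1 h2).add (hv.locL2_fun K h1 h2)
  locL2_grad := fun K h1 h2 => (hu.locL2_grad K h1 h2).add (hv.locL2_grad K h1 h2)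
  zero_trace := by
    obtain ⟨φ, h1, h2, h3⟩ := hu.zero_trace
    obtain ⟨ψ, k1, k2, k3⟩ := hv.zero_trace
    refine ⟨fun n => φ n + ψ n, fun n => ⟨(h1 n).1.add (k1 n).1, (h1 n).2.1.add (k1 n).2.1,
      (tsupport_add _ _).trans (union_subset (h1 n).2.2 (k1 n).2.2)⟩, ?_, ?_⟩
    · exact tendsto_eLpNorm_add (fun n => aesm hu.weakGradient.locInt_fun (h1 n).1.continuous)
        (fun n => aesm hv.weakGradient.locInt_fun (k1 n).1.continuous) h2 k2
    · simp_rw [fun n => classicalGradient_add (h1 n).1 (k1 n).1]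
      exact tendsto_eLpNorm_add
        (fun n => aesm hu.weakGradient.locInt_grad (continuous_classicalGradient (h1 n).1))
        (fun n => aesm hv.weakGradient.locInt_grad (continuous_classicalGradient (k1 n).1)) h3 k3

theorem IsAdmissible.smul {u : E3 → ℂ} {g : E3 → C3} (c : ℂ) (hu : S.IsAdmissible u g) :
    S.IsAdmissible (c • u) (c • g) where
  weakGradient := hu.weakGradient.smul c
  locL2_fun := fun K h1 h2 => (hu.locL2_fun K h1 h2).const_smul c
  locL2_grad := fun K h1 h2 => (hu.locL2_grad K h1 h2).const_smul c
  zero_trace := by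
    obtain ⟨φ, h1, h2, h3⟩ := hu.zero_trace
    refine ⟨fun n => c • φ n, fun n => ⟨(h1 n).1.const_smul c, ?_, ?_⟩, ?_, ?_⟩
    · exact (h1 n).2.1.mono (Function.support_const_smul_subset c (φ n))
    · exact (closure_mono (Function.support_const_smul_subset c (φ n))).trans (h1 n).2.2
    · exact tendsto_eLpNorm_smul c h2
    · simp_rw [fun n => classicalGradient_smul c (h1 n).1]
      exact tendsto_eLpNorm_smul c h3

theorem IsAdmissible.zero : S.IsAdmissible 0 0 where
  weakGradient := HasWeakGradient.zero
  locL2_fun := fun _ _ _ => MemLp.zero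
  locL2_grad := fun _ _ _ => MemLp.zero
  zero_trace := by
    have h0 : classicalGradient (0 : E3 → ℂ) = 0 := by
      ext x i
      simp [classicalGradient]
    refine ⟨fun _ => 0, fun _ => ⟨contDiff_const, HasCompactSupport.zero, ?_⟩, ?_, ?_⟩
    · simp [tsupport]
    · simp
    · simp [h0]

/-- `p` is the triple of `u`, `P_x g` and `(I - P_x) g`. -/
structure Represents (p : S.Ambient) (u : E3 → ℂ) (g : E3 → C3) : Prop where
  fun_eq : p.fst =ᵐ[S.weighted S.weightFun] u
  rad_eq : p.snd.fst =ᵐ[S.weighted S.weightRad] fun x => radialPart x (g x)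
  tan_eq : p.snd.snd =ᵐ[S.weighted S.weightTan] fun x => tangentialPart x (g x)

variable (S) in
/-- The inner product space `X_e` of all `u ∈ H¹_loc(Ω_e)` with `u|_{∂Ω} = 0` and
`⟨(w_rad P_x + w_tan (I - P_x)) ∇u, ∇u⟩ + ⟨w_fun u, u⟩ < ∞`. A function `u` is stored
together with the parts `P_x ∇u` and `(I - P_x) ∇u` of its weak gradient, as an element of the
Hilbert sum of the weighted `L²` spaces, whose inner product is the one of `X_e`. -/
def xeSubmodule : Submodule ℂ S.Ambient where
  carrier := {p | ∃ u g, S.IsAdmissible u g ∧ Represents p u g}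
  zero_mem' := by
    refine ⟨0, 0, IsAdmissible.zero, ?_, ?_, ?_⟩
    · exact Lp.coeFn_zero _ _ _
    · refine (Lp.coeFn_zero _ _ _).trans (.of_forall fun x => ?_)
      simp
    · refine (Lp.coeFn_zero _ _ _).trans (.of_forall fun x => ?_)
      simp
  add_mem' := by
    rintro p q ⟨u, g, h, hp⟩ ⟨v, k, h', hq⟩
    refine ⟨u + v, g + k, h.add h', ?_, ?_, ?_⟩
    · filter_upwards [Lp.coeFn_add p.fst q.fst, hp.fun_eq, hq.fun_eq] with x h1 h2 h3
      exact h1.trans (by simp [h2, h3])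
    · filter_upwards [Lp.coeFn_add p.snd.fst q.snd.fst, hp.rad_eq, hq.rad_eq] with x h1 h2 h3
      exact h1.trans (by simp [h2, h3])
    · filter_upwards [Lp.coeFn_add p.snd.snd q.snd.snd, hp.tan_eq, hq.tan_eq] with x h1 h2 h3
      exact h1.trans (by simp [h2, h3])
  smul_mem' := by
    rintro c p ⟨u, g, h, hp⟩
    refine ⟨c • u, c • g, h.smul c, ?_, ?_, ?_⟩
    · filter_upwards [Lp.coeFn_smul c p.fst, hp.fun_eq] with x h1 h2
      exact h1.trans (by simp [h2])
    · filter_upwards [Lp.coeFn_smul c p.snd.fst, hp.rad_eq] with x h1 h2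
      exact h1.trans (by simp [h2])
    · filter_upwards [Lp.coeFn_smul c p.snd.snd, hp.tan_eq] with x h1 h2
      exact h1.trans (by simp [h2])

variable (S) in
/-- The inner product space `X_e` as a type. -/
def Xe : Type := S.xeSubmodule

instance : NormedAddCommGroup S.Xe := inferInstanceAs (NormedAddCommGroup S.xeSubmodule)

instance : InnerProductSpace ℂ S.Xe := inferInstanceAs (InnerProductSpace ℂ S.xeSubmodule)

/-- An element of `X_e` as an element of the Hilbert sum. -/
def Xe.val (u : S.Xe) : S.Ambient := Subtype.val (p := (· ∈ S.xeSubmodule)) u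

/-- The function on `Ω_e` underlying an element of `X_e`, determined almost everywhere. -/
def toFun (u : S.Xe) : E3 → ℂ := u.val.fst

/-- The norm of `X_e` is `‖u‖² = ∫ |u|² w_fun + ∫ |P_x ∇u|² w_rad + ∫ |(I - P_x) ∇u|² w_tan`. -/
theorem Xe_norm_sq (p : S.Xe) {u : E3 → ℂ} {g : E3 → C3}
    (h : Represents p.val u g) :
    ‖p‖ ^ 2 = (∫ x, ‖u x‖ ^ 2 ∂S.weighted S.weightFun) +
      ((∫ x, ‖radialPart x (g x)‖ ^ 2 ∂S.weighted S.weightRad) +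
        ∫ x, ‖tangentialPart x (g x)‖ ^ 2 ∂S.weighted S.weightTan) := by
  have key : ∀ {F : Type} [NormedAddCommGroup F] [InnerProductSpace ℂ F] {μ : Measure E3}
      (f : Lp F 2 μ) (f' : E3 → F), f =ᵐ[μ] f' → ‖f‖ ^ 2 = ∫ x, ‖f' x‖ ^ 2 ∂μ := by
    intro F _ _ μ f f' hf
    have h1 : ((‖f‖ ^ 2 : ℝ) : ℂ) = ∫ x, ((‖f x‖ ^ 2 : ℝ) : ℂ) ∂μ := by
      have := inner_self_eq_norm_sq_to_K (𝕜 := ℂ) f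
      rw [L2.inner_def] at this
      simp only [inner_self_eq_norm_sq_to_K] at this
      simpa using this.symm
    rw [integral_complex_ofReal] at h1
    rw [Complex.ofReal_inj.1 h1]
    exact integral_congr_ae (hf.mono fun x hx => by simp [hx])
  rw [show ‖p‖ = ‖p.val‖ from rfl, WithLp.prod_norm_sq_eq_of_L2, WithLp.prod_norm_sq_eq_of_L2,
    key _ _ h.fun_eq, key _ _ h.rad_eq, key _ _ h.tan_eq]

/-! ### The operators `T` and the Galerkin spaces -/

variable (S)

open Classical in
/-- The symbol `η_e` of the multiplication operator for the frequency `ω`. -/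
def symbol (ω : ℂ) (r : ℝ) : ℂ :=
  if argNeg (-ω ^ 2 * dZero S.tα ^ 2) < 0 then
    starRingEnd ℂ ((‖S.deHat r‖ : ℂ) / S.deHat r)
  else
    starRingEnd ℂ (S.deHat r / S.deTilde r ^ 2 * ((‖S.deTilde r‖ : ℂ) ^ 2 / (‖S.deHat r‖ : ℂ)))

end Data

/-- `ηε` is a smooth approximation of `η : [r₁, r₂) → ℂ`: it is within distance `ε` of `η` in
`L^∞(r₁, r₂)`, it is smooth in `(r₁, r₂)`, it equals `η(r₁)` near `r₁` and on `[0, r₁]`,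
and it equals `lim_{r → r₂-} η(r)` near `r₂`. -/
structure IsSmoothing (r₁ r₂ ε : ℝ) (η ηε : ℝ → ℂ) : Prop where
  close : eLpNorm (η - ηε) ⊤ (volume.restrict (Ioo r₁ r₂)) < ENNReal.ofReal ε
  contDiffOn : ContDiffOn ℝ (⊤ : ℕ∞) ηε (Ioo r₁ r₂)
  eq_left : ∃ s ∈ Ioo r₁ r₂, ∀ r, 0 ≤ r → r ≤ s → ηε r = η r₁
  eq_right : ∃ s ∈ Ioo r₁ r₂, ∀ r, s ≤ r → r < r₂ → ηε r = limUnder (𝓝[<] r₂) η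

namespace Data

variable (S : Data)

/-- `T ∈ L(X_e)` is the operator of multiplication by the radial function `η(|x|)`. -/
def IsMultiplication (η : ℝ → ℂ) (T : S.Xe →L[ℂ] S.Xe) : Prop :=
  ∀ u : S.Xe, toFun (T u) =ᵐ[volume.restrict S.Ωe] fun x => η ‖x‖ * toFun u x

/-- The operators `Q n` are bounded projections of `X_e` onto `Xh n` that act locally on the scale
`h n → 0`: on balls inside of `Ω_e` in the sense of a local approximation estimate, and on
arbitrary balls (which may meet the boundary of `Ω_e`) in the sense that `Q n u` vanishes on
`B_{h n}(x₀) ∩ Ω_e` if `u` vanishes on `B_{R h n}(x₀) ∩ Ω_e`. -/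
structure IsLocalProjection (Xh : ℕ → Submodule ℂ S.Xe) (h : ℕ → ℝ)
    (Q : ∀ n, S.Xe →L[ℂ] Xh n) : Prop where
  pos : ∀ n, 0 < h n
  tendsto_zero : Tendsto h atTop (𝓝 0)
  projection : ∀ n (v : Xh n), Q n v = v
  local_estimate : ∃ C R : ℝ, 1 < C ∧ 1 < R ∧
    (∀ n, ∀ s ∈ ({1, 2} : Set ℕ), ∀ x₀ ∈ S.Ωe, Metric.ball x₀ (R * h n) ⊆ S.Ωe →
      ∀ u : S.Xe, MemSobolev (Metric.ball x₀ (R * h n)) s (toFun u) →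
        sobolevNorm (Metric.ball x₀ (h n)) 1 (toFun (u - (Q n u : S.Xe))) ≤
          ENNReal.ofReal (C * h n ^ (s - 1)) *
            sobolevNorm (Metric.ball x₀ (R * h n)) s (toFun u)) ∧
    (∀ n, ∀ x₀ ∈ S.Ωe, ∀ u : S.Xe,
      toFun u =ᵐ[volume.restrict (Metric.ball x₀ (R * h n) ∩ S.Ωe)] 0 →
        toFun (Q n u : S.Xe) =ᵐ[volume.restrict (Metric.ball x₀ (h n) ∩ S.Ωe)] 0)

/-- For each compact `D ⊆ Ω_e` and large `n`, `Xh n` contains a function that is `1` on `D`. -/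
def ContainsLocalConstants (Xh : ℕ → Submodule ℂ S.Xe) : Prop :=
  ∀ D ⊆ S.Ωe, IsCompact D → ∃ n₀ : ℕ, ∀ n, n₀ < n →
    ∃ v ∈ Xh n, toFun v =ᵐ[volume.restrict D] 1

end Data

section Operators

variable {X : Type*} [NormedAddCommGroup X] [InnerProductSpace ℂ X]

/-- `A` is a Fredholm operator of index zero. -/
def IsFredholmIndexZero {Y : Type*} [NormedAddCommGroup Y] [NormedSpace ℂ Y] (A : Y →L[ℂ] Y) :
    Prop :=
  A.IsFredholm ∧ Module.finrank ℂ A.ker = Module.finrank ℂ (Y ⧸ A.range)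

/-- The Galerkin operator `Q T|_V` on the subspace `V`. -/
def compress (V : Submodule ℂ X) (Q : X →L[ℂ] V) (T : X →L[ℂ] X) : V →L[ℂ] V :=
  Q ∘L T ∘L V.subtypeL

/-- `sup_{v ∈ V \ {0}} ‖(T - B) v‖ / ‖v‖`, the norm of `(T - B)|_V` as an operator from `V`
to `X`. -/
def discreteNorm (V : Submodule ℂ X) (T : X →L[ℂ] X) (B : V →L[ℂ] V) : ℝ :=
  ‖T ∘L V.subtypeL - V.subtypeL ∘L B‖

end Operators

end ExactPML

end

open ExactPML

/-! The symbol `ηε` is constant on `[0, a]` and on `[b, r₂)` for some `r₁ < a`, `b < r₂`, so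
`ηε(|x|)` is the restriction to `Ω_e` of a smooth function `M` on `ℝ³` whose derivatives live on
the shell `{a ≤ |x| ≤ b}` (`exists_isTransition`). The weights of `X_e` are comparable to
constants on compact shells in `{r₁ < |x| < r₂}`, whence the commutator `u ∇M` in `∇(M u) = M ∇u +
u ∇M` is bounded by the norm of `u`, and multiplication by `M` is a bounded operator `T` on `X_e`
(`Data.IsRegular.exists_isMultiplication`). The Galerkin operators are Fredholm of index zero
because they act on finite dimensional spaces. The norms of `(T - Qₙ T)|_{Vₙ}` tend to zero by the
discrete commutator property `‖(1 - Qₙ) T u‖ ≤ C hₙ ‖u‖` for `u ∈ Vₙ` and large `n`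
(`Data.exists_discrete_commutator_le`).

For the latter, `(1 - Qₙ) T u = (1 - Qₙ) (M - c) u` for every constant `c`, because `Qₙ u = u`.
Where `M` is locally constant, the locality of `Qₙ` shows that `(1 - Qₙ) T u` vanishes
(`Data.ae_eq_zero_of_notMem_shell`); thus only balls `B_{hₙ}(x₀)` near the shell matter. On such a
ball `(M - M(x₀)) u = (M - M(x₀)) (u - u(x₀)) + u(x₀) (M - M(x₀))`. As `|M - M(x₀)| ≲ hₙ`, the
first term has an `H¹` norm of order `hₙ ‖∇u‖ + ‖u - u(x₀)‖`, and the second one is smooth, so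
that the approximation property of `Qₙ` in `H²` gives a factor `hₙ`
(`Data.IsRegular.local_commutator_le`). The function that is one near the shell, which belongs to
the Galerkin spaces by assumption, serves as a cut-off: it makes both terms elements of `X_e`.

The local estimates are added up not by a covering of the shell but by integrating them over `x₀`
(`Data.shellEnergy_le_of_local`), which also gives a meaning to `u(x₀)`. By Tonelli's theorem,
with `y = x₀ + t`, the integral of `|u(y) - u(x₀)|²` over `|y - x₀| < R hₙ` is then controlled by
`‖u(· + t) - u‖² ≤ |t|² ‖∇u‖²` (`HasWeakGradient.lintegral_translate_sub_le`), and no Poincaré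
inequality on balls is needed. -/

namespace ExactPML

/-! ### Calculus of weak gradients -/

theorem setIntegral_eq_of_tsupport_subset {F : Type*} [NormedAddCommGroup F] [NormedSpace ℝ F]
    {D : Set E3} {f : E3 → F} {φ : E3 → ℝ} (hφ : tsupport φ ⊆ D) (hf : ∀ x, φ x = 0 → f x = 0) :
    ∫ x in D, f x = ∫ x, f x :=
  setIntegral_eq_integral_of_forall_compl_eq_zero fun x hx =>
    hf x (image_eq_zero_of_notMem_tsupport fun h => hx (hφ h))

theorem HasWeakGradient.integral_eq_univ {D : Set E3} {u : E3 → ℂ} {g : E3 → C3}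
    (h : HasWeakGradient D u g) {φ : E3 → ℝ} (h1 : ContDiff ℝ (⊤ : ℕ∞) φ)
    (h2 : HasCompactSupport φ) (h3 : tsupport φ ⊆ D) (i : Fin 3) :
    ∫ x, (fderiv ℝ φ x (EuclideanSpace.single i 1)) • u x = - ∫ x, φ x • g x i := by
  have := h.integral_eq φ h1 h2 h3 i
  rwa [setIntegral_eq_of_tsupport_subset ((tsupport_partial_subset i).trans h3)
      (fun x hx => by simp only [hx, zero_smul]),
    setIntegral_eq_of_tsupport_subset h3 (fun x hx => by simp [hx])] at this

theorem HasWeakGradient.mono {D D' : Set E3} {u : E3 → ℂ} {g : E3 → C3}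
    (h : HasWeakGradient D u g) (hsub : D' ⊆ D) : HasWeakGradient D' u g where
  locInt_fun := h.locInt_fun.mono_set hsub
  locInt_grad := h.locInt_grad.mono_set hsub
  integral_eq := by
    intro φ h1 h2 h3 i
    rw [setIntegral_eq_of_tsupport_subset ((tsupport_partial_subset i).trans h3)
      (fun x hx => by simp only [hx, zero_smul]),
      setIntegral_eq_of_tsupport_subset h3 (fun x hx => by simp [hx])]
    exact h.integral_eq_univ h1 h2 (h3.trans hsub) i

theorem locallyIntegrableOn_congr_ae {F : Type*} [NormedAddCommGroup F] {D : Set E3}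
    {f f' : E3 → F} (hf : LocallyIntegrableOn f D volume)
    (h : f =ᵐ[volume.restrict D] f') : LocallyIntegrableOn f' D volume := by
  intro x hx
  obtain ⟨t, ht, hi⟩ := hf x hx
  refine ⟨t ∩ D, inter_mem ht self_mem_nhdsWithin, ?_⟩
  exact (hi.mono_set inter_subset_left).congr_fun_ae
    (ae_restrict_of_ae_restrict_of_subset inter_subset_right h)

theorem HasWeakGradient.congr {D : Set E3} {u u' : E3 → ℂ} {g g' : E3 → C3}
    (h : HasWeakGradient D u g) (hu : u =ᵐ[volume.restrict D] u')
    (hg : g =ᵐ[volume.restrict D] g') : HasWeakGradient D u' g' where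
  locInt_fun := locallyIntegrableOn_congr_ae h.locInt_fun hu
  locInt_grad := locallyIntegrableOn_congr_ae h.locInt_grad hg
  integral_eq := by
    intro φ h1 h2 h3 i
    have e := h.integral_eq φ h1 h2 h3 i
    rw [integral_congr_ae (hu.mono fun x hx => by rw [hx]),
      integral_congr_ae (f := fun x => φ x • g x i) (g := fun x => φ x • g' x i)
        (hg.mono fun x hx => by simp only [hx])] at e
    exact e

/-- Uniqueness of weak gradients, by the fundamental lemma of the calculus of variations. -/
theorem HasWeakGradient.ae_eq {D : Set E3} (hD : IsOpen D) {u : E3 → ℂ} {g g' : E3 → C3}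
    (h : HasWeakGradient D u g) (h' : HasWeakGradient D u g') : g =ᵐ[volume.restrict D] g' := by
  have key : ∀ i : Fin 3, ∀ᵐ x, x ∈ D → g x i - g' x i = 0 := by
    intro i
    have hl : ∀ {w : E3 → C3}, LocallyIntegrableOn w D volume →
        LocallyIntegrableOn (fun x => w x i) D volume := by
      intro w hw x hx
      obtain ⟨t, ht, hi⟩ := hw x hx
      exact ⟨t, ht, (EuclideanSpace.proj i : C3 →L[ℂ] ℂ).integrable_comp hi⟩
    refine hD.ae_eq_zero_of_integral_contDiff_smul_eq_zero
      ((hl h.locInt_grad).sub (hl h'.locInt_grad)) fun φ h1 h2 h3 => ?_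
    have e := h.integral_eq φ h1 h2 h3 i
    rw [h'.integral_eq φ h1 h2 h3 i, neg_inj] at e
    rw [← setIntegral_eq_of_tsupport_subset h3 (fun x hx => by simp [hx])]
    simp only [smul_sub]
    rw [integral_sub (integrable_testFunction_smul (hl h.locInt_grad) h1.continuous h2 h3)
      (integrable_testFunction_smul (hl h'.locInt_grad) h1.continuous h2 h3), e, sub_self]
  refine (ae_restrict_iff' hD.measurableSet).2 ?_
  filter_upwards [ae_all_iff.2 key] with x hx hxD
  ext i
  exact sub_eq_zero.1 (hx i hxD)

theorem contDiff_partial {φ : E3 → ℂ} (h1 : ContDiff ℝ (⊤ : ℕ∞) φ) (v : E3) :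
    ContDiff ℝ (⊤ : ℕ∞) fun x => fderiv ℝ φ x v :=
  (h1.fderiv_right (by simp)).clm_apply contDiff_const

/-- The defining identity of weak gradients holds for complex test functions as well. -/
theorem HasWeakGradient.integral_eq_complex {D : Set E3} {u : E3 → ℂ} {g : E3 → C3}
    (h : HasWeakGradient D u g) {φ : E3 → ℂ} (h1 : ContDiff ℝ (⊤ : ℕ∞) φ)
    (h2 : HasCompactSupport φ) (h3 : tsupport φ ⊆ D) (i : Fin 3) :
    ∫ x in D, fderiv ℝ φ x (EuclideanSpace.single i 1) * u x = - ∫ x in D, φ x * g x i := by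
  have part : ∀ L : ℂ →L[ℝ] ℝ,
      Integrable (fun x => (L (fderiv ℝ φ x (EuclideanSpace.single i 1))) • u x)
        (volume.restrict D) ∧
      Integrable (fun x => L (φ x) • g x i) (volume.restrict D) ∧
      ∫ x in D, (L (fderiv ℝ φ x (EuclideanSpace.single i 1))) • u x =
        - ∫ x in D, L (φ x) • g x i := by
    intro L
    have c1 : ContDiff ℝ (⊤ : ℕ∞) fun x => L (φ x) := L.contDiff.comp h1
    have c2 : HasCompactSupport fun x => L (φ x) := h2.comp_left (map_zero L)
    have c3 : tsupport (fun x => L (φ x)) ⊆ D := (tsupport_comp_subset (map_zero L) φ).trans h3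
    have e : ∀ x v, fderiv ℝ (fun x => L (φ x)) x v = L (fderiv ℝ φ x v) := by
      intro x v
      have := (L.hasFDerivAt.comp x (h1.differentiable (by simp) x).hasFDerivAt).fderiv
      rw [show (fun x => L (φ x)) = L ∘ φ from rfl, this]
      rfl
    have i1 := h.integral_eq _ c1 c2 c3 i
    have hc : Continuous fun x => fderiv ℝ (fun x => L (φ x)) x (EuclideanSpace.single i 1) :=
      (c1.continuous_fderiv (by simp)).clm_apply continuous_const
    have i2 := integrable_testFunction_smul h.locInt_fun hc
      (c2.mono' ((subset_tsupport _).trans (tsupport_partial_subset i)))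
      ((tsupport_partial_subset i).trans c3)
    have i3 := (EuclideanSpace.proj i : C3 →L[ℂ] ℂ).integrable_comp
      (integrable_testFunction_smul h.locInt_grad c1.continuous c2 c3)
    simp only [e] at i1 i2
    exact ⟨i2, by simpa using i3, i1⟩
  obtain ⟨a1, a2, a3⟩ := part Complex.reCLM
  obtain ⟨b1, b2, b3⟩ := part Complex.imCLM
  have split : ∀ z w : ℂ, z * w = Complex.reCLM z • w + Complex.I * (Complex.imCLM z • w) := by
    intro z w
    conv_lhs => rw [← Complex.re_add_im z]
    simp only [Complex.reCLM_apply, Complex.imCLM_apply, Complex.real_smul]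
    ring
  rw [integral_congr_ae (.of_forall fun x => split _ _),
    integral_congr_ae (f := fun x => φ x * g x i) (.of_forall fun x => split _ _),
    integral_add a1 (b1.const_mul _), integral_add a2 (b2.const_mul _), integral_const_mul,
    integral_const_mul, a3, b3]
  ring

theorem HasWeakGradient.mul {D : Set E3} (hD : IsOpen D) {u : E3 → ℂ} {g : E3 → C3}
    (h : HasWeakGradient D u g) {M : E3 → ℂ} (hM : ContDiff ℝ (⊤ : ℕ∞) M) :
    HasWeakGradient D (fun x => M x * u x)
      (fun x => M x • g x + u x • classicalGradient M x) := by
  have l1 := h.locInt_fun.continuousOn_smul hD.isLocallyClosed hM.continuous.continuousOn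
  have l2 := h.locInt_grad.continuousOn_smul hD.isLocallyClosed hM.continuous.continuousOn
  have l3 := h.locInt_fun.smul_continuousOn hD.isLocallyClosed
    (continuous_classicalGradient hM).continuousOn
  refine ⟨l1, l2.add l3, fun φ h1 h2 h3 i => ?_⟩
  have c1 : ContDiff ℝ (⊤ : ℕ∞) fun x => φ x • M x := h1.smul hM
  have e := h.integral_eq_complex c1 h2.smul_right ((tsupport_smul_subset_left φ M).trans h3) i
  have d : ∀ x v, fderiv ℝ (fun x => φ x • M x) x v
      = φ x • fderiv ℝ M x v + fderiv ℝ φ x v • M x := by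
    intro x v
    rw [fderiv_fun_smul (h1.differentiable (by simp) x) (hM.differentiable (by simp) x)]
    simp
  have hc : Continuous fun x => fderiv ℝ φ x (EuclideanSpace.single i 1) :=
    (h1.continuous_fderiv (by simp)).clm_apply continuous_const
  have j1 := integrable_testFunction_smul l1 hc
      (h2.mono' ((subset_tsupport _).trans (tsupport_partial_subset i)))
      ((tsupport_partial_subset i).trans h3)
  have j2 := (EuclideanSpace.proj i : C3 →L[ℂ] ℂ).integrable_comp
    (integrable_testFunction_smul l2 h1.continuous h2 h3)
  have j3 := (EuclideanSpace.proj i : C3 →L[ℂ] ℂ).integrable_comp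
    (integrable_testFunction_smul l3 h1.continuous h2 h3)
  simp only [d] at e
  simp only [PiLp.proj_apply, PiLp.smul_apply, smul_eq_mul, classicalGradient] at j1 j2 j3
  simp only [PiLp.add_apply, PiLp.smul_apply, smul_eq_mul, classicalGradient, smul_add]
  rw [integral_add j2 j3]
  have j3' : Integrable (fun x => φ x • fderiv ℝ M x (EuclideanSpace.single i 1) * u x)
      (volume.restrict D) := j3.congr (.of_forall fun x => by simp; ring)
  rw [integral_congr_ae (g := fun x => φ x • fderiv ℝ M x (EuclideanSpace.single i 1) * u x +
      (fderiv ℝ φ x (EuclideanSpace.single i 1)) • (M x * u x))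
      (.of_forall fun x => by simp; ring), integral_add j3' j1] at e
  rw [integral_congr_ae (f := fun x => φ x • M x * g x i) (g := fun x => φ x • (M x * g x i))
      (.of_forall fun x => by simp; ring)] at e
  rw [integral_congr_ae (f := fun x => φ x • (u x * fderiv ℝ M x (EuclideanSpace.single i 1)))
      (g := fun x => φ x • fderiv ℝ M x (EuclideanSpace.single i 1) * u x)
      (.of_forall fun x => by simp; ring)]
  linear_combination e

theorem HasWeakGradient.one (D : Set E3) : HasWeakGradient D (fun _ => 1) 0 where
  locInt_fun := locallyIntegrableOn_const 1
  locInt_grad := locallyIntegrableOn_zero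
  integral_eq := by
    intro φ h1 h2 h3 i
    rw [setIntegral_eq_of_tsupport_subset ((tsupport_partial_subset i).trans h3)
      (fun x hx => by simp only [hx, zero_smul])]
    have hc : Continuous fun x => fderiv ℝ φ x (EuclideanSpace.single i 1) :=
      (h1.continuous_fderiv (by simp)).clm_apply continuous_const
    have hs : HasCompactSupport fun x => fderiv ℝ φ x (EuclideanSpace.single i 1) :=
      h2.mono' ((subset_tsupport _).trans (tsupport_partial_subset i))
    have := integral_bilinear_fderiv_right_eq_neg_left_of_integrable (μ := (volume : Measure E3))
      (f := fun _ => (1 : ℝ)) (g := φ) (v := EuclideanSpace.single i 1)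
      (B := ContinuousLinearMap.mul ℝ ℝ) (by simp)
      (by simpa using hc.integrable_of_hasCompactSupport hs)
      (by simpa using h1.continuous.integrable_of_hasCompactSupport h2)
      (fun _ _ => by fun_prop) (fun x _ => h1.differentiable (by simp) x)
    simp only [ContinuousLinearMap.mul_apply', one_mul] at this
    rw [integral_smul_const, this]
    simp

theorem HasWeakGradient.const (D : Set E3) (c : ℂ) : HasWeakGradient D (fun _ => c) 0 := by
  have := (HasWeakGradient.one D).smul c
  rw [smul_zero] at this
  convert this using 1
  ext x
  simp

theorem HasWeakGradient.of_contDiff {D : Set E3} (hD : IsOpen D) {M : E3 → ℂ}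
    (hM : ContDiff ℝ (⊤ : ℕ∞) M) : HasWeakGradient D M (classicalGradient M) := by
  simpa using (HasWeakGradient.one D).mul hD hM

/-! ### Sobolev norms -/

theorem sobolevSq_congr {D : Set E3} {u u' : E3 → ℂ}
    (h : u =ᵐ[volume.restrict D] u') (k : ℕ) : sobolevSq D k u = sobolevSq D k u' := by
  have h0 : ∫⁻ x in D, ‖u x‖ₑ ^ 2 = ∫⁻ x in D, ‖u' x‖ₑ ^ 2 :=
    lintegral_congr_ae (h.mono fun x hx => by simp only [hx])
  cases k with
  | zero => exact h0
  | succ k =>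
    have h1 : ∀ g, HasWeakGradient D u g ↔ HasWeakGradient D u' g := fun g =>
      ⟨fun H => H.congr h (.refl _ _), fun H => H.congr h.symm (.refl _ _)⟩
    simp only [sobolevSq, h0, h1]

theorem C3_enorm_sq (v : C3) : ‖v‖ₑ ^ 2 = ∑ i, ‖v i‖ₑ ^ 2 := by
  have h : ‖v‖₊ ^ 2 = ∑ i, ‖v i‖₊ ^ 2 := by
    ext
    simp [EuclideanSpace.norm_sq_eq]
  simp only [enorm_eq_nnnorm]
  exact_mod_cast h

theorem lintegral_C3_enorm_sq {μ : Measure E3} {g : E3 → C3} (hg : AEStronglyMeasurable g μ) :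
    ∑ i : Fin 3, ∫⁻ x, ‖g x i‖ₑ ^ 2 ∂μ = ∫⁻ x, ‖g x‖ₑ ^ 2 ∂μ := by
  simp_rw [C3_enorm_sq]
  rw [lintegral_finsetSum']
  intro i _
  exact (((EuclideanSpace.proj i : C3 →L[ℂ] ℂ).continuous.comp_aestronglyMeasurable
    hg).enorm).pow_const 2

/-- The infimum in `sobolevSq D 1 u` is attained, as weak gradients are unique almost everywhere. -/
theorem sobolevSq_one_eq {D : Set E3} (hD : IsOpen D) {u : E3 → ℂ} {g : E3 → C3}
    (h : HasWeakGradient D u g) :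
    sobolevSq D 1 u = (∫⁻ x in D, ‖u x‖ₑ ^ 2) + ∫⁻ x in D, ‖g x‖ₑ ^ 2 := by
  simp only [sobolevSq]
  congr 1
  apply le_antisymm
  · refine (iInf₂_le g h).trans ?_
    rw [lintegral_C3_enorm_sq h.locInt_grad.aestronglyMeasurable]
  · refine le_iInf₂ fun g' h' => ?_
    rw [lintegral_C3_enorm_sq h'.locInt_grad.aestronglyMeasurable]
    exact (lintegral_congr_ae ((h.ae_eq hD h').mono fun x hx => by simp only [hx])).le

/-- A crude bound of the `H²` norm of a smooth function;
`7 = 1 + 3 (1 + 1)` counts the integrals. -/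
theorem sobolevSq_two_le {D : Set E3} (hD : IsOpen D) {u : E3 → ℂ} (h : ContDiff ℝ (⊤ : ℕ∞) u)
    {C : ℝ≥0∞} (h0 : ∀ x ∈ D, ‖u x‖ₑ ^ 2 ≤ C)
    (h1 : ∀ i : Fin 3, ∀ x ∈ D, ‖fderiv ℝ u x (EuclideanSpace.single i 1)‖ₑ ^ 2 ≤ C)
    (h2 : ∀ i : Fin 3, ∀ x ∈ D, ‖classicalGradient
      (fun y => fderiv ℝ u y (EuclideanSpace.single i 1)) x‖ₑ ^ 2 ≤ C) :
    sobolevSq D 2 u ≤ 7 * (C * volume D) := by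
  have B : ∀ {F : Type} [NormedAddCommGroup F] (f : E3 → F), (∀ x ∈ D, ‖f x‖ₑ ^ 2 ≤ C) →
      ∫⁻ x in D, ‖f x‖ₑ ^ 2 ≤ C * volume D := by
    intro F _ f hf
    refine (setLIntegral_mono' hD.measurableSet hf).trans ?_
    simp
  have e : sobolevSq D 2 u ≤ (∫⁻ x in D, ‖u x‖ₑ ^ 2) +
      ∑ i : Fin 3, sobolevSq D 1 (fun x => classicalGradient u x i) := by
    rw [sobolevSq]
    gcongr
    exact iInf₂_le _ (HasWeakGradient.of_contDiff hD h)
  refine e.trans ?_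
  have s : ∀ i : Fin 3, sobolevSq D 1 (fun x => classicalGradient u x i)
      ≤ C * volume D + C * volume D := by
    intro i
    have := sobolevSq_one_eq hD (HasWeakGradient.of_contDiff hD
      (contDiff_partial h (EuclideanSpace.single i 1)))
    refine this.le.trans (add_le_add (B _ (h1 i)) (B _ (h2 i)))
  refine (add_le_add (B u h0) (Finset.sum_le_sum fun i _ => s i)).trans (le_of_eq ?_)
  simp
  ring

/-! ### Translates of weakly differentiable functions -/

/-- The derivative `∑ i, tᵢ gᵢ` in direction `t` belonging to the gradient `g`. -/
def directional (t : E3) (v : C3) : ℂ := ∑ i, (t i : ℂ) * v i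

theorem enorm_directional_le (t : E3) (v : C3) : ‖directional t v‖ₑ ≤ ‖t‖ₑ * ‖v‖ₑ := by
  have h : ‖directional t v‖ ≤ ‖t‖ * ‖v‖ := by
    have h1 : directional t v = inner ℂ (WithLp.toLp 2 fun i => (t i : ℂ) : C3) v := by
      simp [directional, PiLp.inner_apply, mul_comm]
    have h2 : ‖(WithLp.toLp 2 fun i => (t i : ℂ) : C3)‖ = ‖t‖ := by
      simp [EuclideanSpace.norm_eq]
    rw [h1, ← h2]
    exact norm_inner_le_norm _ _
  simp only [← ofReal_norm, ← ENNReal.ofReal_mul (norm_nonneg t)]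
  exact ENNReal.ofReal_le_ofReal h

theorem continuous_directional (t : E3) : Continuous (directional t) := by
  unfold directional
  fun_prop

theorem fderiv_apply_eq_sum (φ : E3 → ℝ) (x t : E3) :
    fderiv ℝ φ x t = ∑ i, t i * fderiv ℝ φ x (EuclideanSpace.single i 1) := by
  have : t = ∑ i, t i • EuclideanSpace.single i (1 : ℝ) := by
    ext j
    simp [Finset.sum_apply, Pi.single_apply]
  conv_lhs => rw [this]
  simp

/-- The weak gradient in the direction `t`, tested with `φ`. -/
theorem HasWeakGradient.integral_directional {D : Set E3} {u : E3 → ℂ} {g : E3 → C3}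
    (h : HasWeakGradient D u g) {φ : E3 → ℝ} (h1 : ContDiff ℝ (⊤ : ℕ∞) φ)
    (h2 : HasCompactSupport φ) (h3 : tsupport φ ⊆ D) (t : E3) :
    ∫ x, (fderiv ℝ φ x t) • u x = - ∫ x, φ x • directional t (g x) := by
  have i1 : ∀ i, Integrable (fun x => (t i : ℂ) *
      ((fderiv ℝ φ x (EuclideanSpace.single i 1)) • u x)) := by
    intro i
    have hc : Continuous fun x => fderiv ℝ φ x (EuclideanSpace.single i 1) :=
      (h1.continuous_fderiv (by simp)).clm_apply continuous_const
    have := integrable_testFunction_smul h.locInt_fun hc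
      (h2.mono' ((subset_tsupport _).trans (tsupport_partial_subset i)))
      ((tsupport_partial_subset i).trans h3)
    refine ((integrableOn_iff_integrable_of_support_subset ?_).1 this).const_mul _
    intro x hx
    by_contra hxD
    apply hx
    have : fderiv ℝ φ x (EuclideanSpace.single i 1) = 0 :=
      image_eq_zero_of_notMem_tsupport
        (f := fun x => fderiv ℝ φ x (EuclideanSpace.single i 1))
        fun h => hxD (h3 (tsupport_partial_subset i h))
    simp only [this, zero_smul]
  have i2 : ∀ i, Integrable (fun x => (t i : ℂ) * (φ x • g x i)) := by
    intro i
    have := (EuclideanSpace.proj i : C3 →L[ℂ] ℂ).integrable_comp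
      (integrable_testFunction_smul h.locInt_grad h1.continuous h2 h3)
    refine ((integrableOn_iff_integrable_of_support_subset ?_).1 this).const_mul _
    intro x hx
    by_contra hxD
    apply hx
    have : φ x = 0 := image_eq_zero_of_notMem_tsupport fun h => hxD (h3 h)
    simp [this]
  calc ∫ x, (fderiv ℝ φ x t) • u x
      = ∫ x, ∑ i, (t i : ℂ) * ((fderiv ℝ φ x (EuclideanSpace.single i 1)) • u x) := by
        congr 1
        ext x
        rw [fderiv_apply_eq_sum, Finset.sum_smul]
        simp [mul_assoc]
    _ = ∑ i, (t i : ℂ) * ∫ x, (fderiv ℝ φ x (EuclideanSpace.single i 1)) • u x := by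
        rw [integral_finsetSum _ fun i _ => i1 i]
        simp_rw [integral_const_mul]
    _ = - ∑ i, (t i : ℂ) * ∫ x, φ x • g x i := by
        simp_rw [h.integral_eq_univ h1 h2 h3, mul_neg, Finset.sum_neg_distrib]
    _ = - ∫ x, φ x • directional t (g x) := by
        simp_rw [← integral_const_mul]
        rw [← integral_finsetSum _ fun i _ => i2 i]
        congr 2
        ext x
        simp only [directional, Finset.smul_sum]
        exact Finset.sum_congr rfl fun i _ => by simp; ring

/-- The fundamental theorem of calculus along the segments `[x, x + t]`, for almost every `x`. It is
proved by duality: the identity is tested with `φ`, the difference is moved onto `φ`, and the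
weak gradient is applied to each of the translates `φ (· - s t)`. -/
theorem HasWeakGradient.ae_sub_eq_integral {D : Set E3} {u : E3 → ℂ} {g : E3 → C3}
    (h : HasWeakGradient D u g) {K U : Set E3} (hK : IsCompact K) (hKD : K ⊆ D) (hU : IsOpen U)
    (t : E3) (hUK : ∀ x ∈ U, ∀ s ∈ Icc (0 : ℝ) 1, x + s • t ∈ K) :
    ∀ᵐ x, x ∈ U → u (x + t) - u x =
      ∫ s in Icc (0 : ℝ) 1, K.indicator (fun y => directional t (g y)) (x + s • t) := by
  set u1 : E3 → ℂ := K.indicator u with hu1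
  set l : E3 → ℂ := K.indicator (fun y => directional t (g y)) with hl
  have iu : Integrable u1 :=
    (integrable_indicator_iff hK.measurableSet).2 (h.locInt_fun.integrableOn_compact_subset hKD hK)
  have il : Integrable l := by
    refine (integrable_indicator_iff hK.measurableSet).2 ?_
    have hg := h.locInt_grad.integrableOn_compact_subset hKD hK
    refine integrable_finsetSum _ fun i _ => ?_
    exact ((EuclideanSpace.proj i : C3 →L[ℂ] ℂ).integrable_comp hg).const_mul _
  set I : Measure ℝ := volume.restrict (Icc (0 : ℝ) 1) with hI
  have shear : MeasurePreserving (fun p : ℝ × E3 => (p.1, p.2 + p.1 • t))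
      (I.prod volume) (I.prod volume) := by
    refine MeasurePreserving.skew_product (g := fun s x => x + s • t) (MeasurePreserving.id I) ?_ ?_
    · exact Continuous.measurable (by fun_prop)
    · exact .of_forall fun s => (measurePreserving_add_right volume (s • t)).map_eq
  have il2 : Integrable (fun p : ℝ × E3 => l (p.2 + p.1 • t)) (I.prod volume) := by
    have := shear.integrable_comp_of_integrable (il.comp_snd I)
    exact this
  set W : E3 → ℂ := fun x => ∫ s, l (x + s • t) ∂I with hW
  have iW : Integrable W := il2.integral_prod_right
  have iut : Integrable (fun x => u1 (x + t)) := iu.comp_add_right t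
  have main : ∀ᵐ x, x ∈ U → u1 (x + t) - u1 x - W x = 0 := by
    refine hU.ae_eq_zero_of_integral_contDiff_smul_eq_zero
      (((iut.sub iu).sub iW).locallyIntegrable.locallyIntegrableOn U) fun φ h1 h2 h3 => ?_
    obtain ⟨B, hB⟩ := h2.exists_bound_of_continuous h1.continuous
    have bd : ∀ {f : E3 → ℂ}, Integrable f → Integrable (fun x => φ x • f x) := fun hf =>
      hf.bdd_smul B h1.continuous.aestronglyMeasurable (.of_forall hB)
    -- the test function moved by `s t`
    have step : ∀ s ∈ Icc (0 : ℝ) 1,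
        ∫ x, (-(fderiv ℝ φ (x - s • t) t)) • u1 x = ∫ x, φ x • l (x + s • t) := by
      intro s hs
      set ψ : E3 → ℝ := fun x => φ (x - s • t) with hψ
      have p1 : ContDiff ℝ (⊤ : ℕ∞) ψ := h1.comp (contDiff_id.sub contDiff_const)
      have p2 : HasCompactSupport ψ := h2.comp_homeomorph (Homeomorph.subRight (s • t))
      have p3 : tsupport ψ ⊆ K := by
        intro x hx
        have : x - s • t ∈ tsupport φ :=
          (Set.ext_iff.mp (tsupport_comp_eq_preimage φ (Homeomorph.subRight (s • t))) x).mp hx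
        simpa using hUK _ (h3 this) s hs
      have p4 : ∀ x, fderiv ℝ ψ x t = fderiv ℝ φ (x - s • t) t := fun x => by
        rw [hψ, fderiv_comp_sub]
      have p5 := h.integral_directional p1 p2 (p3.trans hKD) t
      have e1 : ∫ x, (-(fderiv ℝ φ (x - s • t) t)) • u1 x = - ∫ x, (fderiv ℝ ψ x t) • u x := by
        rw [← integral_neg]
        congr 1
        ext x
        rw [p4, neg_smul]
        by_cases hx : x ∈ K
        · simp [hu1, hx]
        · rw [← p4, show fderiv ℝ ψ x t = 0 from image_eq_zero_of_notMem_tsupport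
            (f := fun x => fderiv ℝ ψ x t)
            fun h => hx (p3 (tsupport_fderiv_apply_subset ℝ t h))]
          simp
      rw [e1, p5, neg_neg, ← integral_add_right_eq_self _ (s • t)]
      congr 1
      ext x
      simp only [hψ, add_sub_cancel_right]
      by_cases hx : x + s • t ∈ K
      · simp [hl, hx]
      · have : φ x = 0 := by
          by_contra h0
          exact hx (hUK _ (h3 (subset_tsupport _ h0)) s hs)
        simp [this]
    have ftc : ∀ x, φ (x - t) - φ x = ∫ s, -(fderiv ℝ φ (x - s • t) t) ∂I := by
      intro x
      have hd : ∀ s ∈ uIcc (0 : ℝ) 1, HasDerivAt (fun s : ℝ => φ (x - s • t))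
          (-(fderiv ℝ φ (x - s • t) t)) s := by
        intro s _
        have a1 : HasDerivAt (fun s : ℝ => x - s • t) (-t) s := by
          simpa using ((hasDerivAt_id s).smul_const t).const_sub x
        have := (h1.differentiable (by simp) (x - s • t)).hasFDerivAt.comp_hasDerivAt s a1
        rw [map_neg] at this
        exact this
      have hc : Continuous fun s : ℝ => -(fderiv ℝ φ (x - s • t) t) :=
        (((h1.continuous_fderiv (by simp)).comp (by fun_prop)).clm_apply continuous_const).neg
      have := intervalIntegral.integral_eq_sub_of_hasDerivAt hd (hc.intervalIntegrable 0 1)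
      rw [intervalIntegral.integral_of_le zero_le_one, ← integral_Icc_eq_integral_Ioc] at this
      simpa using this.symm
    have hc2 : Continuous fun x => fderiv ℝ φ x t :=
      (h1.continuous_fderiv (by simp)).clm_apply continuous_const
    obtain ⟨B', hB'⟩ := (h2.fderiv_apply (𝕜 := ℝ) (v := t)).exists_bound_of_continuous hc2
    have j1 : Integrable (fun p : E3 × ℝ => (-(fderiv ℝ φ (p.1 - p.2 • t) t)) • u1 p.1)
        ((volume : Measure E3).prod I) := by
      refine (iu.comp_fst I).bdd_smul (φ := fun p : E3 × ℝ => -(fderiv ℝ φ (p.1 - p.2 • t) t)) B' ?_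
        (.of_forall fun p => ?_)
      · exact Continuous.aestronglyMeasurable (hc2.comp (by fun_prop)).neg
      · rw [norm_neg]
        exact hB' _
    have j2 : Integrable (fun p : ℝ × E3 => φ p.2 • l (p.2 + p.1 • t)) (I.prod volume) :=
      il2.bdd_smul B (h1.continuous.comp continuous_snd).aestronglyMeasurable
        (.of_forall fun p => hB _)
    have lhs : ∫ x, (φ (x - t) - φ x) • u1 x = ∫ x, φ x • W x := by
      calc ∫ x, (φ (x - t) - φ x) • u1 x
          = ∫ x, ∫ s, (-(fderiv ℝ φ (x - s • t) t)) • u1 x ∂I := by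
            congr 1
            ext x
            rw [ftc, integral_smul_const]
        _ = ∫ s, (∫ x, (-(fderiv ℝ φ (x - s • t) t)) • u1 x) ∂I := integral_integral_swap j1
        _ = ∫ s, (∫ x, φ x • l (x + s • t)) ∂I :=
            setIntegral_congr_fun measurableSet_Icc step
        _ = ∫ x, ∫ s, φ x • l (x + s • t) ∂I := integral_integral_swap j2
        _ = ∫ x, φ x • W x := by
            congr 1
            ext x
            rw [integral_smul]
    have sh : ∫ x, φ x • u1 (x + t) = ∫ x, φ (x - t) • u1 x := by
      rw [← integral_add_right_eq_self (fun x => φ (x - t) • u1 x) t]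
      simp
    have bt : Integrable (fun x => φ (x - t) • u1 x) :=
      iu.bdd_smul B (h1.continuous.comp (by fun_prop)).aestronglyMeasurable
        (.of_forall fun x => hB _)
    simp only [smul_sub]
    rw [integral_sub (f := fun x => φ x • u1 (x + t) - φ x • u1 x) ((bd iut).sub (bd iu)) (bd iW),
      integral_sub (bd iut) (bd iu), sh, ← lhs,
      ← integral_sub bt (bd iu), ← integral_sub]
    · simp [sub_smul]
    · exact bt.sub (bd iu)
    · simp only [sub_smul]
      exact bt.sub (bd iu)
  filter_upwards [main] with x hx hxU
  have k0 : x ∈ K := by simpa using hUK x hxU 0 (by simp)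
  have k1 : x + t ∈ K := by simpa using hUK x hxU 1 (by simp)
  have := sub_eq_zero.1 (hx hxU)
  simpa only [hu1, indicator_of_mem k0, indicator_of_mem k1] using this

theorem sq_lintegral_le {α : Type*} [MeasurableSpace α] {μ : Measure α} [IsProbabilityMeasure μ]
    {f : α → ℝ≥0∞} (hf : AEMeasurable f μ) : (∫⁻ x, f x ∂μ) ^ 2 ≤ ∫⁻ x, f x ^ 2 ∂μ := by
  have h := ENNReal.lintegral_mul_le_Lp_mul_Lq μ (p := 2) (q := 2)
    Real.HolderConjugate.two_two hf (g := 1) aemeasurable_const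
  have h' : ∫⁻ x, f x ∂μ ≤ (∫⁻ x, f x ^ 2 ∂μ) ^ (1 / 2 : ℝ) := by simpa using h
  calc (∫⁻ x, f x ∂μ) ^ 2 ≤ ((∫⁻ x, f x ^ 2 ∂μ) ^ (1 / 2 : ℝ)) ^ 2 := by gcongr
    _ = ∫⁻ x, f x ^ 2 ∂μ := by
      rw [← ENNReal.rpow_natCast, ← ENNReal.rpow_mul]
      norm_num

/-- The difference quotients of `u` are bounded in `L²` by its weak gradient. -/
theorem HasWeakGradient.lintegral_translate_sub_le {D : Set E3} {u : E3 → ℂ} {g : E3 → C3}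
    (h : HasWeakGradient D u g) (hg : StronglyMeasurable g) {K U : Set E3}
    (hK : IsCompact K) (hKD : K ⊆ D) (hU : IsOpen U) (t : E3)
    (hUK : ∀ x ∈ U, ∀ s ∈ Icc (0 : ℝ) 1, x + s • t ∈ K) :
    ∫⁻ x in U, ‖u (x + t) - u x‖ₑ ^ 2 ≤ ‖t‖ₑ ^ 2 * ∫⁻ x in K, ‖g x‖ₑ ^ 2 := by
  set I : Measure ℝ := volume.restrict (Icc (0 : ℝ) 1) with hI
  have : IsProbabilityMeasure I := ⟨by simp [hI]⟩
  set F : E3 → ℝ≥0∞ := K.indicator fun y => ‖directional t (g y)‖ₑ ^ 2 with hF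
  have ml : StronglyMeasurable (K.indicator fun y => directional t (g y)) :=
    ((continuous_directional t).comp_stronglyMeasurable hg).indicator hK.measurableSet
  have mF : Measurable F :=
    (((continuous_directional t).comp_stronglyMeasurable hg).enorm.pow_const 2).indicator
      hK.measurableSet
  calc ∫⁻ x in U, ‖u (x + t) - u x‖ₑ ^ 2
      ≤ ∫⁻ x in U, ∫⁻ s, F (x + s • t) ∂I := by
        refine lintegral_mono_ae ((ae_restrict_iff' hU.measurableSet).2 ?_)
        filter_upwards [h.ae_sub_eq_integral hK hKD hU t hUK] with x hx hxU
        rw [hx hxU]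
        refine (pow_le_pow_left' (enorm_integral_le_lintegral_enorm _) 2).trans ?_
        refine (sq_lintegral_le ?_).trans (le_of_eq ?_)
        · exact (ml.enorm.comp (by fun_prop)).aemeasurable
        · congr 1
          ext s
          by_cases hs : x + s • t ∈ K <;> simp [hF, hs]
    _ ≤ ∫⁻ x, ∫⁻ s, F (x + s • t) ∂I := setLIntegral_le_lintegral _ _
    _ = ∫⁻ s, (∫⁻ x, F (x + s • t)) ∂I :=
        lintegral_lintegral_swap (mF.comp (by fun_prop)).aemeasurable
    _ = ∫⁻ _, (∫⁻ x, F x) ∂I :=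
        lintegral_congr fun s => lintegral_add_right_eq_self F (s • t)
    _ = ∫⁻ x, F x := by simp
    _ = ∫⁻ x in K, ‖directional t (g x)‖ₑ ^ 2 := lintegral_indicator hK.measurableSet _
    _ ≤ ∫⁻ x in K, ‖t‖ₑ ^ 2 * ‖g x‖ₑ ^ 2 := by
        refine lintegral_mono fun x => ?_
        rw [← mul_pow]
        exact pow_le_pow_left' (enorm_directional_le t (g x)) 2
    _ = ‖t‖ₑ ^ 2 * ∫⁻ x in K, ‖g x‖ₑ ^ 2 := by
        rw [lintegral_const_mul' _ _ (by simp)]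

/-! ### Averages over balls -/

theorem setLIntegral_ball_eq (F : E3 → ℝ≥0∞) (x : E3) (r : ℝ) :
    ∫⁻ y in Metric.ball x r, F y = ∫⁻ t in Metric.ball 0 r, F (x + t) := by
  rw [← lintegral_indicator Metric.isOpen_ball.measurableSet,
    ← lintegral_indicator Metric.isOpen_ball.measurableSet,
    ← lintegral_add_left_eq_self _ x]
  congr 1
  ext t
  simp [indicator]

/-- Tonelli's theorem in the variables `x` and `t = y - x`. -/
theorem lintegral_setLIntegral_ball {G : E3 → E3 → ℝ≥0∞} (hG : Measurable (Function.uncurry G))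
    (A : Set E3) (r : ℝ) :
    ∫⁻ x in A, ∫⁻ y in Metric.ball x r, G x y =
      ∫⁻ t in Metric.ball 0 r, ∫⁻ x in A, G x (x + t) := by
  refine (lintegral_congr fun x => setLIntegral_ball_eq (G x) x r).trans ?_
  refine lintegral_lintegral_swap (Measurable.aemeasurable ?_)
  exact hG.comp (f := fun p : E3 × E3 => (p.1, p.1 + p.2)) (by fun_prop)

theorem setLIntegral_translate_eq (F : E3 → ℝ≥0∞) {A : Set E3} (hA : MeasurableSet A) (t : E3) :
    ∫⁻ x in A, F (x + t) = ∫⁻ y in (fun y => y - t) ⁻¹' A, F y := by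
  rw [← lintegral_indicator hA, ← lintegral_indicator (hA.preimage (by fun_prop)),
    ← lintegral_add_right_eq_self (((fun y => y - t) ⁻¹' A).indicator F) t]
  congr 1
  ext x
  have e : x + t ∈ (fun y => y - t) ⁻¹' A ↔ x ∈ A := by
    rw [mem_preimage, add_sub_cancel_right]
  by_cases hx : x ∈ A
  · rw [indicator_of_mem hx, indicator_of_mem (e.2 hx)]
  · rw [indicator_of_notMem hx, indicator_of_notMem (mt e.1 hx)]

/-- Averaging a local quantity over the balls about the points of `A` counts each point at most
`|B_r|` times. -/
theorem lintegral_setLIntegral_ball_le {F : E3 → ℝ≥0∞} (hF : Measurable F) {A A' : Set E3}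
    (hA : MeasurableSet A) {r : ℝ} (h : ∀ x ∈ A, Metric.ball x r ⊆ A') :
    ∫⁻ x in A, ∫⁻ y in Metric.ball x r, F y ≤
      volume (Metric.ball (0 : E3) r) * ∫⁻ y in A', F y := by
  rw [lintegral_setLIntegral_ball (G := fun _ y => F y) (hF.comp measurable_snd)]
  refine (setLIntegral_mono' Metric.isOpen_ball.measurableSet (g := fun _ => ∫⁻ y in A', F y)
    fun t ht => ?_).trans (by simp [mul_comm])
  rw [setLIntegral_translate_eq F hA]
  refine lintegral_mono_set fun y hy => h _ hy ?_
  simpa [mem_ball_iff_norm] using ht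

/-- Averaging a local quantity over the balls about the points of `A` counts each point `|B_r|`
times, if the ball about that point is contained in `A`. -/
theorem le_lintegral_setLIntegral_ball {F : E3 → ℝ≥0∞} (hF : Measurable F) {A A' : Set E3}
    (hA : MeasurableSet A) {r : ℝ} (h : ∀ x ∈ A', Metric.ball x r ⊆ A) :
    volume (Metric.ball (0 : E3) r) * ∫⁻ y in A', F y ≤
      ∫⁻ x in A, ∫⁻ y in Metric.ball x r, F y := by
  rw [lintegral_setLIntegral_ball (G := fun _ y => F y) (hF.comp measurable_snd)]
  refine le_trans (by simp [mul_comm]) (setLIntegral_mono' Metric.isOpen_ball.measurableSet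
    (f := fun _ => ∫⁻ y in A', F y) fun t ht => ?_)
  rw [setLIntegral_translate_eq F hA]
  refine lintegral_mono_set fun y hy => h _ hy ?_
  simpa [mem_ball_iff_norm] using ht

/-! ### The radial weights -/

section Radial

variable {r₁ r₂ : ℝ} {re tα : ℝ → ℝ}

theorem IsExteriorDomain.pos {Ω : Set E3} (h : IsExteriorDomain Ω r₁) : 0 < r₁ := by
  obtain ⟨x, hx⟩ := h.nonempty_compl
  have := h.compl_subset hx
  rw [mem_ball_zero_iff] at this
  exact (norm_nonneg x).trans_lt this

theorem IsDomainTransformation.strictMonoOn (hr : IsDomainTransformation r₁ r₂ re) (h1 : 0 < r₁) :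
    StrictMonoOn re (Ioo 0 r₂) := by
  have hlt := hr.lt
  refine (ContinuousOn.strictMonoOn_of_injOn_Ioo (h1.trans hlt) hr.continuousOn
    hr.bijOn.injOn).resolve_right fun hanti => ?_
  have := hanti (a := r₁ / 2) (b := r₁) ⟨by linarith, by linarith⟩ ⟨h1, hlt⟩ (by linarith)
  rw [hr.eq_self _ h1 le_rfl, hr.eq_self (r₁ / 2) (by linarith) (by linarith)] at this
  linarith

theorem IsDomainTransformation.lt_re (hr : IsDomainTransformation r₁ r₂ re) (h1 : 0 < r₁)
    {r : ℝ} (h : r ∈ Ioo r₁ r₂) : r₁ < re r := by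
  have := hr.strictMonoOn h1 ⟨h1, hr.lt⟩ ⟨h1.trans h.1, h.2⟩ h.1
  rwa [hr.eq_self _ h1 le_rfl] at this

theorem IsDomainTransformation.deriv_pos (hr : IsDomainTransformation r₁ r₂ re) (h1 : 0 < r₁)
    {r : ℝ} (h : r ∈ Ioo r₁ r₂) : 0 < deriv re r := by
  have hm : MonotoneOn re (Ioo r₁ r₂) :=
    ((hr.strictMonoOn h1).mono (Ioo_subset_Ioo_left h1.le)).monotoneOn
  have := hm.derivWithin_nonneg (x := r)
  rw [derivWithin_of_isOpen isOpen_Ioo h] at this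
  exact lt_of_le_of_ne this (hr.deriv_ne_zero r h).symm

theorem dTilde_ne_zero (r : ℝ) : dTilde tα r ≠ 0 := fun h => by
  simpa [dTilde] using congrArg Complex.re h

theorem dFun_ne_zero (r : ℝ) : dFun tα r ≠ 0 := fun h => by
  simpa [dFun] using congrArg Complex.re h

theorem IsProfile.continuousOn_alpha (hα : IsProfile r₁ tα) (h1 : 0 < r₁) :
    ContinuousOn (alpha tα) (Ioi r₁) := by
  have hd : ContinuousOn (deriv tα) (Ioi r₁) :=
    hα.contDiffOn.continuousOn_deriv_of_isOpen isOpen_Ioi (by norm_num)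
  exact (continuousOn_id.mul hd).add
    (hα.continuousOn.mono fun x hx => (h1.trans hx).le)

end Radial

/-- The closed spherical shell `{a ≤ |x| ≤ b}`. -/
def shell (a b : ℝ) : Set E3 := {x | a ≤ ‖x‖ ∧ ‖x‖ ≤ b}

theorem isClosed_shell (a b : ℝ) : IsClosed (shell a b) :=
  (isClosed_le continuous_const continuous_norm).inter
    (isClosed_le continuous_norm continuous_const)

theorem isCompact_shell (a b : ℝ) : IsCompact (shell a b) :=
  (isCompact_closedBall (0 : E3) b).of_isClosed_subset (isClosed_shell a b) fun x hx => by
    simpa using hx.2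

theorem measurableSet_shell (a b : ℝ) : MeasurableSet (shell a b) :=
  (isClosed_shell a b).measurableSet

theorem ball_subset_shell {a b a' b' δ : ℝ} (ha : a' + δ ≤ a) (hb : b + δ ≤ b') {x : E3}
    (hx : x ∈ shell a b) : Metric.ball x δ ⊆ shell a' b' := by
  intro y hy
  rw [mem_ball_iff_norm] at hy
  have := abs_le.1 (abs_norm_sub_norm_le y x)
  exact ⟨by linarith [hx.1], by linarith [hx.2]⟩

namespace Data

variable {S : Data}

theorem shell_subset_Ωe (hΩ : IsExteriorDomain S.Ω S.r₁) {a b : ℝ} (ha : S.r₁ < a) (hb : b < S.r₂) :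
    shell a b ⊆ S.Ωe := by
  intro x hx
  refine ⟨?_, by simpa using hx.2.trans_lt hb⟩
  by_contra h
  have := hΩ.compl_subset h
  rw [mem_ball_zero_iff] at this
  linarith [hx.1]

theorem isOpen_Ωe (hΩ : IsExteriorDomain S.Ω S.r₁) : IsOpen S.Ωe :=
  hΩ.isLipschitzDomain.isOpen.inter Metric.isOpen_ball

/-- The assumptions on the profile and on the domain transformation. -/
structure IsRegular (S : Data) : Prop where
  exterior : IsExteriorDomain S.Ω S.r₁
  profile : IsProfile S.r₁ S.tα
  transformation : IsDomainTransformation S.r₁ S.r₂ S.re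

namespace IsRegular

theorem pos (h : S.IsRegular) : 0 < S.r₁ := h.exterior.pos

theorem continuousOn_radial (h : S.IsRegular) :
    ContinuousOn S.re (Ioo S.r₁ S.r₂) ∧ ContinuousOn S.γe (Ioo S.r₁ S.r₂) ∧
      ContinuousOn S.γeTilde (Ioo S.r₁ S.r₂) ∧ ContinuousOn S.deTilde (Ioo S.r₁ S.r₂) ∧
      ContinuousOn S.de (Ioo S.r₁ S.r₂) := by
  have h1 := h.pos
  have c1 : ContinuousOn S.re (Ioo S.r₁ S.r₂) :=
    h.transformation.continuousOn.mono (Ioo_subset_Ioo_left h1.le)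
  have m1 : MapsTo S.re (Ioo S.r₁ S.r₂) (Ioi S.r₁) := fun r hr => h.transformation.lt_re h1 hr
  have ca : ContinuousOn (fun r => S.tα (S.re r)) (Ioo S.r₁ S.r₂) :=
    h.profile.continuousOn.comp c1 fun r hr => (h1.trans (m1 hr)).le
  have cb : ContinuousOn (fun r => alpha S.tα (S.re r)) (Ioo S.r₁ S.r₂) :=
    (h.profile.continuousOn_alpha h1).comp c1 m1
  refine ⟨c1, h.transformation.contDiffOn.continuousOn_deriv_of_isOpen isOpen_Ioo (by norm_num),
    c1.div continuousOn_id fun r hr => (h1.trans hr.1).ne', ?_, ?_⟩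
  · exact continuousOn_const.add (continuousOn_const.mul
      (Complex.continuous_ofReal.comp_continuousOn ca))
  · exact continuousOn_const.add (continuousOn_const.mul
      (Complex.continuous_ofReal.comp_continuousOn cb))

theorem continuousOn_weights (h : S.IsRegular) :
    ContinuousOn S.weightFun {x | ‖x‖ ∈ Ioo S.r₁ S.r₂} ∧
      ContinuousOn S.weightRad {x | ‖x‖ ∈ Ioo S.r₁ S.r₂} ∧
      ContinuousOn S.weightTan {x | ‖x‖ ∈ Ioo S.r₁ S.r₂} := by
  obtain ⟨-, c2, c3, c4, c5⟩ := h.continuousOn_radial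
  have lift : ∀ {W : ℝ → ℝ}, ContinuousOn W (Ioo S.r₁ S.r₂) →
      ContinuousOn (fun x : E3 => W ‖x‖) {x | ‖x‖ ∈ Ioo S.r₁ S.r₂} := fun hW =>
    hW.comp continuous_norm.continuousOn fun x hx => hx
  refine ⟨lift (W := fun r => S.γeTilde r ^ 2 * S.γe r * ‖S.deTilde r ^ 2 * S.de r‖) ?_,
    lift (W := fun r => S.γeTilde r ^ 2 * (S.γe r)⁻¹ * ‖S.deTilde r ^ 2 * (S.de r)⁻¹‖) ?_,
    lift (W := fun r => S.γe r * ‖S.de r‖) ?_⟩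
  · exact ((c3.pow 2).mul c2).mul ((c4.pow 2).mul c5).norm
  · exact ((c3.pow 2).mul (c2.inv₀ h.transformation.deriv_ne_zero)).mul
      ((c4.pow 2).mul (c5.inv₀ fun r _ => dFun_ne_zero _)).norm
  · exact c2.mul c5.norm

theorem weights_pos (h : S.IsRegular) {x : E3} (hx : ‖x‖ ∈ Ioo S.r₁ S.r₂) :
    0 < S.weightFun x ∧ 0 < S.weightRad x ∧ 0 < S.weightTan x := by
  have h1 := h.pos
  have g : 0 < S.γe ‖x‖ := h.transformation.deriv_pos h1 hx
  have gt : 0 < S.γeTilde ‖x‖ := div_pos (h1.trans (h.transformation.lt_re h1 hx)) (h1.trans hx.1)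
  have d1 : S.deTilde ‖x‖ ≠ 0 := dTilde_ne_zero _
  have d2 : S.de ‖x‖ ≠ 0 := dFun_ne_zero _
  refine ⟨?_, ?_, ?_⟩
  · exact mul_pos (mul_pos (pow_pos gt 2) g) (norm_pos_iff.2 (mul_ne_zero (pow_ne_zero 2 d1) d2))
  · exact mul_pos (mul_pos (pow_pos gt 2) (inv_pos.2 g))
      (norm_pos_iff.2 (mul_ne_zero (pow_ne_zero 2 d1) (inv_ne_zero d2)))
  · unfold weightTan; positivity

theorem weightFun_eq_one (h : S.IsRegular) {x : E3} (hx : ‖x‖ ∈ Ioo 0 S.r₁) :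
    S.weightFun x = 1 := by
  have hne : (‖x‖ : ℝ) ≠ 0 := hx.1.ne'
  have e0 : S.re ‖x‖ = ‖x‖ := h.transformation.eq_self _ hx.1 hx.2.le
  have e1 : S.γe ‖x‖ = 1 := by
    have : S.re =ᶠ[𝓝 ‖x‖] id := by
      filter_upwards [isOpen_Ioo.mem_nhds hx] with r hr
      exact h.transformation.eq_self r hr.1 hr.2.le
    rw [γe, this.deriv_eq]
    simp
  have e2 : S.tα ‖x‖ = 0 := h.profile.eq_zero _ hx.1.le hx.2.le
  have e3 : deriv S.tα ‖x‖ = 0 := by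
    have : S.tα =ᶠ[𝓝 ‖x‖] fun _ => 0 := by
      filter_upwards [isOpen_Ioo.mem_nhds hx] with r hr
      exact h.profile.eq_zero r hr.1.le hr.2.le
    rw [this.deriv_eq]
    simp
  simp [weightFun, γeTilde, deTilde, de, dTilde, dFun, alpha, e0, e1, e2, e3, hne]

/-- The spheres `|x| = 0` and `|x| = r₁`, at which the weights may be singular, are null sets. -/
theorem ae_norm_mem (h : S.IsRegular) :
    ∀ᵐ x ∂volume.restrict S.Ωe, ‖x‖ ∈ Ioo 0 S.r₁ ∨ ‖x‖ ∈ Ioo S.r₁ S.r₂ := by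
  have s0 : ∀ᵐ x : E3, x ∉ Metric.sphere (0 : E3) 0 :=
    measure_eq_zero_iff_ae_notMem.1 (Measure.addHaar_sphere _ _ _)
  have s1 : ∀ᵐ x : E3, x ∉ Metric.sphere (0 : E3) S.r₁ :=
    measure_eq_zero_iff_ae_notMem.1 (Measure.addHaar_sphere _ _ _)
  refine (ae_restrict_iff' (isOpen_Ωe h.exterior).measurableSet).2 ?_
  filter_upwards [s0, s1] with x h0 h1 hx
  have h2 := hx.2
  simp only [mem_sphere_iff_norm, sub_zero] at h0 h1
  rw [mem_ball_zero_iff] at h2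
  have h3 : 0 < ‖x‖ := lt_of_le_of_ne (norm_nonneg x) (Ne.symm h0)
  rcases lt_or_gt_of_ne h1 with h4 | h4
  · exact Or.inl ⟨h3, h4⟩
  · exact Or.inr ⟨h4, h2⟩

/-- Since the weight is positive almost everywhere, the function underlying an element of `X_e` is
determined Lebesgue almost everywhere in `Ω_e`. -/
theorem volume_absolutelyContinuous (h : S.IsRegular) :
    volume.restrict S.Ωe ≪ S.weighted S.weightFun := by
  refine withDensity_absolutelyContinuous' ?_ ?_
  · set A : Set E3 := {x | ‖x‖ ∈ Ioo 0 S.r₁}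
    set B : Set E3 := {x | ‖x‖ ∈ Ioo S.r₁ S.r₂}
    have mA : MeasurableSet A := (isOpen_Ioo.preimage continuous_norm).measurableSet
    have mB : MeasurableSet B := (isOpen_Ioo.preimage continuous_norm).measurableSet
    have hw : AEMeasurable S.weightFun (volume.restrict (A ∪ B)) := by
      refine aemeasurable_union_iff.2 ⟨?_, h.continuousOn_weights.1.aemeasurable mB⟩
      exact (aemeasurable_const (b := (1 : ℝ))).congr
        ((ae_restrict_iff' mA).2 (.of_forall fun x hx => (h.weightFun_eq_one hx).symm))
    have hle : volume.restrict S.Ωe ≤ volume.restrict (A ∪ B) := by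
      rw [← Measure.restrict_eq_self_of_ae_mem (s := A ∪ B) (μ := volume.restrict S.Ωe)
        h.ae_norm_mem]
      rw [Measure.restrict_restrict (mA.union mB)]
      exact Measure.restrict_mono inter_subset_left le_rfl
    exact (hw.mono_measure hle).ennreal_ofReal
  · filter_upwards [h.ae_norm_mem] with x hx
    simp only [ne_eq, ENNReal.ofReal_eq_zero, not_le]
    rcases hx with hx | hx
    · rw [h.weightFun_eq_one hx]
      exact one_pos
    · exact (h.weights_pos hx).1

/-- The weights are comparable to `1` on a shell inside of `{r₁ < |x| < r₂}`. They may degenerate at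
the spheres `|x| = r₁` and `|x| = r₂`. -/
theorem exists_weight_bound (h : S.IsRegular) {a b : ℝ} (ha : S.r₁ < a) (hb : b < S.r₂) :
    ∃ C : NNReal, ∀ w ∈ ({S.weightFun, S.weightRad, S.weightTan} : Set (E3 → ℝ)),
      ∀ x ∈ shell a b, ENNReal.ofReal (w x) ≤ C ∧ 1 ≤ C * ENNReal.ofReal (w x) := by
  have hsub : shell a b ⊆ {x | ‖x‖ ∈ Ioo S.r₁ S.r₂} := fun x hx =>
    ⟨ha.trans_le hx.1, hx.2.trans_lt hb⟩
  have single : ∀ w : E3 → ℝ, ContinuousOn w {x | ‖x‖ ∈ Ioo S.r₁ S.r₂} →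
      (∀ x ∈ shell a b, 0 < w x) → ∃ C : NNReal, ∀ D : NNReal, C ≤ D →
      ∀ x ∈ shell a b, ENNReal.ofReal (w x) ≤ D ∧ 1 ≤ D * ENNReal.ofReal (w x) := by
    intro w hw hp
    obtain ⟨C1, h1⟩ := (isCompact_shell a b).exists_bound_of_continuousOn (hw.mono hsub)
    obtain ⟨C2, h2⟩ := (isCompact_shell a b).exists_bound_of_continuousOn
      ((hw.mono hsub).inv₀ fun x hx => (hp x hx).ne')
    refine ⟨C1.toNNReal ⊔ C2.toNNReal, fun D hD x hx => ?_⟩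
    have d1 : C1 ≤ D := (Real.le_coe_toNNReal C1).trans (by exact_mod_cast (le_sup_left.trans hD))
    have d2 : C2 ≤ D := (Real.le_coe_toNNReal C2).trans (by exact_mod_cast (le_sup_right.trans hD))
    have e1 : w x ≤ D := (le_abs_self _).trans ((h1 x hx).trans d1)
    have e2 : (w x)⁻¹ ≤ D := (le_abs_self _).trans ((h2 x hx).trans d2)
    constructor
    · rw [← ENNReal.ofReal_coe_nnreal]
      exact ENNReal.ofReal_le_ofReal e1
    · rw [← ENNReal.ofReal_coe_nnreal, ← ENNReal.ofReal_mul D.coe_nonneg, ← ENNReal.ofReal_one]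
      apply ENNReal.ofReal_le_ofReal
      rw [inv_le_iff_one_le_mul₀ (hp x hx)] at e2
      exact e2
  obtain ⟨c1, c2, c3⟩ := h.continuousOn_weights
  obtain ⟨C1, h1⟩ := single _ c1 fun x hx => (h.weights_pos (hsub hx)).1
  obtain ⟨C2, h2⟩ := single _ c2 fun x hx => (h.weights_pos (hsub hx)).2.1
  obtain ⟨C3, h3⟩ := single _ c3 fun x hx => (h.weights_pos (hsub hx)).2.2
  refine ⟨C1 ⊔ C2 ⊔ C3, ?_⟩
  rintro w (rfl | rfl | rfl)
  · exact h1 _ (le_sup_left.trans le_sup_left)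
  · exact h2 _ (le_sup_right.trans le_sup_left)
  · exact h3 _ le_sup_right

end IsRegular

theorem restrict_weighted (w : E3 → ℝ) {K : Set E3} (hK : MeasurableSet K) (hsub : K ⊆ S.Ωe) :
    (S.weighted w).restrict K =
      (volume.restrict K).withDensity fun x => ENNReal.ofReal (w x) := by
  rw [weighted, restrict_withDensity hK, Measure.restrict_restrict hK, inter_eq_left.2 hsub]

theorem setLIntegral_weighted_le {w : E3 → ℝ} {K : Set E3} (hK : MeasurableSet K)
    (hsub : K ⊆ S.Ωe) {C : NNReal} (hC : ∀ x ∈ K, ENNReal.ofReal (w x) ≤ C) (F : E3 → ℝ≥0∞) :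
    ∫⁻ x in K, F x ∂S.weighted w ≤ C * ∫⁻ x in K, F x := by
  rw [restrict_weighted w hK hsub, ← lintegral_const_mul' _ _ (by simp)]
  have : (volume.restrict K).withDensity (fun x => ENNReal.ofReal (w x)) ≤
      (C : ℝ≥0∞) • volume.restrict K := by
    rw [← withDensity_const]
    exact withDensity_mono ((ae_restrict_iff' hK).2 (.of_forall hC))
  refine (lintegral_mono' this le_rfl).trans ?_
  rw [lintegral_smul_measure, lintegral_const_mul' _ _ (by simp), smul_eq_mul]

theorem setLIntegral_le_weighted {w : E3 → ℝ} {K : Set E3} (hK : MeasurableSet K)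
    (hsub : K ⊆ S.Ωe) {C : NNReal} (hC : ∀ x ∈ K, 1 ≤ C * ENNReal.ofReal (w x))
    (F : E3 → ℝ≥0∞) :
    ∫⁻ x in K, F x ≤ C * ∫⁻ x in K, F x ∂S.weighted w := by
  rw [restrict_weighted w hK hsub]
  have : volume.restrict K ≤
      (C : ℝ≥0∞) • (volume.restrict K).withDensity (fun x => ENNReal.ofReal (w x)) := by
    rw [← withDensity_smul' _ _ (by simp)]
    conv_lhs => rw [← withDensity_one (μ := volume.restrict K)]
    exact withDensity_mono ((ae_restrict_iff' hK).2 (.of_forall hC))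
  refine (lintegral_mono' this le_rfl).trans ?_
  rw [lintegral_smul_measure, smul_eq_mul]

end Data

/-! ### Radial and tangential parts -/

theorem enorm_add_sq_le {F : Type*} [SeminormedAddCommGroup F] (a b : F) :
    ‖a + b‖ₑ ^ 2 ≤ 2 * ‖a‖ₑ ^ 2 + 2 * ‖b‖ₑ ^ 2 := by
  have h : ‖a + b‖₊ ^ 2 ≤ 2 * ‖a‖₊ ^ 2 + 2 * ‖b‖₊ ^ 2 := by
    rw [← mul_add]
    exact (pow_le_pow_left' (nnnorm_add_le a b) 2).trans add_sq_le
  simp only [enorm_eq_nnnorm]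
  exact_mod_cast h

theorem lintegral_enorm_add_sq_le {α F : Type*} [MeasurableSpace α] {μ : Measure α}
    [SeminormedAddCommGroup F] {a : α → F} (ha : AEStronglyMeasurable a μ) (b : α → F) :
    ∫⁻ x, ‖a x + b x‖ₑ ^ 2 ∂μ ≤ 2 * (∫⁻ x, ‖a x‖ₑ ^ 2 ∂μ) + 2 * ∫⁻ x, ‖b x‖ₑ ^ 2 ∂μ := by
  rw [← lintegral_const_mul' _ _ (by simp), ← lintegral_const_mul' _ _ (by simp),
    ← lintegral_add_left' ((ha.enorm.pow_const 2).const_mul 2)]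
  exact lintegral_mono fun x => enorm_add_sq_le _ _

theorem radialPart_eq (x : E3) (v : C3) :
    radialPart x v = (((‖x‖ ^ 2)⁻¹ : ℝ) : ℂ) • directional x v •
      (WithLp.toLp 2 fun i => (x i : ℂ) : C3) := by
  ext i
  simp only [radialPart, Px, Matrix.toLpLin_apply, Matrix.mulVec, dotProduct, Matrix.of_apply,
    PiLp.smul_apply, smul_eq_mul, directional, Finset.sum_mul, Finset.mul_sum]
  refine Finset.sum_congr rfl fun j _ => ?_
  push_cast
  ring

theorem tangentialPart_eq (x : E3) (v : C3) : tangentialPart x v = v - radialPart x v := by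
  simp [tangentialPart, radialPart]

theorem enorm_radialPart_le (x : E3) (v : C3) : ‖radialPart x v‖ₑ ≤ ‖v‖ₑ := by
  have h2 : ‖(WithLp.toLp 2 fun i => (x i : ℂ) : C3)‖ₑ = ‖x‖ₑ := by
    rw [← ofReal_norm, ← ofReal_norm]
    congr 1
    simp [EuclideanSpace.norm_eq]
  rw [radialPart_eq, enorm_smul, enorm_smul, h2]
  rcases eq_or_ne x 0 with rfl | hx
  · simp
  have h3 : ‖(((‖x‖ ^ 2)⁻¹ : ℝ) : ℂ)‖ₑ * (‖x‖ₑ * ‖x‖ₑ) = 1 := by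
    have hp : 0 < ‖x‖ := norm_pos_iff.2 hx
    rw [← ofReal_norm, ← ofReal_norm, ← ENNReal.ofReal_mul hp.le,
      ← ENNReal.ofReal_mul (norm_nonneg _), ← ENNReal.ofReal_one]
    congr 1
    rw [Complex.norm_real, Real.norm_of_nonneg (by positivity)]
    field_simp
  calc _ ≤ ‖(((‖x‖ ^ 2)⁻¹ : ℝ) : ℂ)‖ₑ * (‖x‖ₑ * ‖v‖ₑ * ‖x‖ₑ) := by
        gcongr
        exact enorm_directional_le x v
    _ = ‖(((‖x‖ ^ 2)⁻¹ : ℝ) : ℂ)‖ₑ * (‖x‖ₑ * ‖x‖ₑ) * ‖v‖ₑ := by ring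
    _ = ‖v‖ₑ := by rw [h3, one_mul]

theorem enorm_tangentialPart_sq_le (x : E3) (v : C3) :
    ‖tangentialPart x v‖ₑ ^ 2 ≤ 4 * ‖v‖ₑ ^ 2 := by
  rw [tangentialPart_eq, sub_eq_add_neg]
  refine (enorm_add_sq_le _ _).trans ?_
  rw [enorm_neg]
  calc _ ≤ 2 * ‖v‖ₑ ^ 2 + 2 * ‖v‖ₑ ^ 2 := by
        gcongr
        exact enorm_radialPart_le x v
    _ = 4 * ‖v‖ₑ ^ 2 := by ring

theorem aestronglyMeasurable_radialPart {μ : Measure E3} {g : E3 → C3}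
    (hg : AEStronglyMeasurable g μ) : AEStronglyMeasurable (fun x => radialPart x (g x)) μ := by
  simp_rw [radialPart_eq]
  have hd : AEStronglyMeasurable (fun x => directional x (g x)) μ := by
    unfold directional
    refine Finset.aestronglyMeasurable_fun_sum _ fun i _ => AEStronglyMeasurable.mul ?_ ?_
    · exact (Complex.continuous_ofReal.comp
        (EuclideanSpace.proj i : E3 →L[ℝ] ℝ).continuous).aestronglyMeasurable
    · exact (EuclideanSpace.proj i : C3 →L[ℂ] ℂ).continuous.comp_aestronglyMeasurable hg
  have hx : AEStronglyMeasurable (fun x : E3 => (WithLp.toLp 2 fun i => (x i : ℂ) : C3)) μ :=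
    ((PiLp.continuous_toLp 2 _).comp (continuous_pi fun i => Complex.continuous_ofReal.comp
      (EuclideanSpace.proj i : E3 →L[ℝ] ℝ).continuous)).aestronglyMeasurable
  have hc : AEStronglyMeasurable (fun x : E3 => (((‖x‖ ^ 2)⁻¹ : ℝ) : ℂ)) μ :=
    (Complex.measurable_ofReal.comp (measurable_norm.pow_const 2).inv).aestronglyMeasurable
  exact hc.smul (hd.smul hx)

theorem aestronglyMeasurable_tangentialPart {μ : Measure E3} {g : E3 → C3}
    (hg : AEStronglyMeasurable g μ) : AEStronglyMeasurable (fun x => tangentialPart x (g x)) μ := by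
  simp_rw [tangentialPart_eq]
  exact hg.sub (aestronglyMeasurable_radialPart hg)

namespace Data

variable {S : Data}

/-! ### The space `X_e` -/

theorem weighted_absolutelyContinuous (w : E3 → ℝ) : S.weighted w ≪ volume.restrict S.Ωe :=
  withDensity_absolutelyContinuous _ _

theorem IsAdmissible.congr {u u' : E3 → ℂ} {g g' : E3 → C3} (h : S.IsAdmissible u g)
    (hu : u =ᵐ[volume.restrict S.Ωe] u') (hg : g =ᵐ[volume.restrict S.Ωe] g') :
    S.IsAdmissible u' g' where
  weakGradient := h.weakGradient.congr hu hg
  locL2_fun := fun K hK hc =>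
    (h.locL2_fun K hK hc).ae_eq (ae_restrict_of_ae_restrict_of_subset hK hu)
  locL2_grad := fun K hK hc =>
    (h.locL2_grad K hK hc).ae_eq (ae_restrict_of_ae_restrict_of_subset hK hg)
  zero_trace := by
    obtain ⟨φ, h1, h2, h3⟩ := h.zero_trace
    refine ⟨φ, h1, ?_, ?_⟩
    · refine h2.congr fun k => eLpNorm_congr_ae ?_
      filter_upwards [ae_restrict_of_ae_restrict_of_subset inter_subset_left hu] with x hx
      simp [hx]
    · refine h3.congr fun k => eLpNorm_congr_ae ?_
      filter_upwards [ae_restrict_of_ae_restrict_of_subset inter_subset_left hg] with x hx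
      simp [hx]

theorem stronglyMeasurable_toFun (p : S.Xe) : StronglyMeasurable (toFun p) :=
  Lp.stronglyMeasurable p.val.fst

/-- `g` is a measurable weak gradient of the element `p` of `X_e`. -/
structure IsGradient (p : S.Xe) (g : E3 → C3) : Prop where
  measurable : StronglyMeasurable g
  admissible : S.IsAdmissible (toFun p) g
  represents : Represents p.val (toFun p) g

namespace IsRegular

theorem exists_isGradient (h : S.IsRegular) (p : S.Xe) : ∃ g, IsGradient p g := by
  obtain ⟨u, g, ha, hr⟩ := p.2
  have hu : u =ᵐ[volume.restrict S.Ωe] toFun p := h.volume_absolutelyContinuous hr.fun_eq.symm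
  have hm := ha.weakGradient.locInt_grad.aestronglyMeasurable
  refine ⟨hm.mk g, hm.stronglyMeasurable_mk, ha.congr hu hm.ae_eq_mk, .refl _ _, ?_, ?_⟩
  · refine hr.rad_eq.trans ?_
    filter_upwards [weighted_absolutelyContinuous _ hm.ae_eq_mk] with x hx
    rw [← hx]
  · refine hr.tan_eq.trans ?_
    filter_upwards [weighted_absolutelyContinuous _ hm.ae_eq_mk] with x hx
    rw [← hx]

theorem toFun_add (h : S.IsRegular) (p q : S.Xe) :
    toFun (p + q) =ᵐ[volume.restrict S.Ωe] fun x => toFun p x + toFun q x :=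
  h.volume_absolutelyContinuous (Lp.coeFn_add p.val.fst q.val.fst)

theorem toFun_sub (h : S.IsRegular) (p q : S.Xe) :
    toFun (p - q) =ᵐ[volume.restrict S.Ωe] fun x => toFun p x - toFun q x :=
  h.volume_absolutelyContinuous (Lp.coeFn_sub p.val.fst q.val.fst)

theorem toFun_smul (h : S.IsRegular) (c : ℂ) (p : S.Xe) :
    toFun (c • p) =ᵐ[volume.restrict S.Ωe] fun x => c * toFun p x :=
  h.volume_absolutelyContinuous (Lp.coeFn_smul c p.val.fst)

end IsRegular

theorem Xe_enorm_sq (p : S.Xe) {u : E3 → ℂ} {g : E3 → C3} (hr : Represents p.val u g) :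
    ‖p‖ₑ ^ 2 = (∫⁻ x, ‖u x‖ₑ ^ 2 ∂S.weighted S.weightFun) +
      ((∫⁻ x, ‖radialPart x (g x)‖ₑ ^ 2 ∂S.weighted S.weightRad) +
        ∫⁻ x, ‖tangentialPart x (g x)‖ₑ ^ 2 ∂S.weighted S.weightTan) := by
  have key : ∀ {F : Type} [NormedAddCommGroup F] {μ : Measure E3}
      (f : Lp F 2 μ) (f' : E3 → F), f =ᵐ[μ] f' → ‖f‖ₑ ^ 2 = ∫⁻ x, ‖f' x‖ₑ ^ 2 ∂μ := by
    intro F _ μ f f' hf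
    rw [Lp.enorm_def, eLpNorm_congr_ae hf,
      eLpNorm_eq_lintegral_rpow_enorm_toReal (by norm_num) (by norm_num),
      ← ENNReal.rpow_natCast, ← ENNReal.rpow_mul]
    simp
  have split : ∀ {A B : Type} [NormedAddCommGroup A] [NormedAddCommGroup B] (q : WithLp 2 (A × B)),
      ‖q‖ₑ ^ 2 = ‖q.fst‖ₑ ^ 2 + ‖q.snd‖ₑ ^ 2 := by
    intro A B _ _ q
    simp only [← ofReal_norm, ← ENNReal.ofReal_pow (norm_nonneg _)]
    rw [← ENNReal.ofReal_add (by positivity) (by positivity), WithLp.prod_norm_sq_eq_of_L2]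
  rw [show ‖p‖ₑ = ‖p.val‖ₑ from rfl, split, split, key _ _ hr.fun_eq, key _ _ hr.rad_eq,
    key _ _ hr.tan_eq]

/-- An admissible function of finite energy belongs to `X_e`. -/
theorem exists_of_isAdmissible {u : E3 → ℂ} {g : E3 → C3} (ha : S.IsAdmissible u g)
    (h1 : ∫⁻ x, ‖u x‖ₑ ^ 2 ∂S.weighted S.weightFun < ⊤)
    (h2 : ∫⁻ x, ‖radialPart x (g x)‖ₑ ^ 2 ∂S.weighted S.weightRad < ⊤)
    (h3 : ∫⁻ x, ‖tangentialPart x (g x)‖ₑ ^ 2 ∂S.weighted S.weightTan < ⊤) :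
    ∃ p : S.Xe, Represents p.val u g := by
  have key : ∀ {F : Type} [NormedAddCommGroup F] {μ : Measure E3} {f : E3 → F},
      AEStronglyMeasurable f μ → ∫⁻ x, ‖f x‖ₑ ^ 2 ∂μ < ⊤ → MemLp f 2 μ := by
    intro F _ μ f hm hf
    refine ⟨hm, ?_⟩
    rw [eLpNorm_eq_lintegral_rpow_enorm_toReal (by norm_num) (by norm_num)]
    exact ENNReal.rpow_lt_top_of_nonneg (by norm_num) (by simpa using hf.ne)
  have hmu : ∀ w, AEStronglyMeasurable u (S.weighted w) := fun w =>
    ha.weakGradient.locInt_fun.aestronglyMeasurable.mono_ac (weighted_absolutelyContinuous w)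
  have hmg : ∀ w, AEStronglyMeasurable g (S.weighted w) := fun w =>
    ha.weakGradient.locInt_grad.aestronglyMeasurable.mono_ac (weighted_absolutelyContinuous w)
  have m1 := key (hmu _) h1
  have m2 := key (aestronglyMeasurable_radialPart (hmg _)) h2
  have m3 := key (aestronglyMeasurable_tangentialPart (hmg _)) h3
  have hr : Represents (S := S) (WithLp.toLp 2 (m1.toLp _, WithLp.toLp 2 (m2.toLp _, m3.toLp _)))
      u g := ⟨m1.coeFn_toLp, m2.coeFn_toLp, m3.coeFn_toLp⟩
  exact ⟨⟨_, u, g, ha, hr⟩, hr⟩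

namespace IsRegular

/-- An element of `X_e` is determined by its function, since its gradient is. -/
theorem toFun_injective (h : S.IsRegular) {p q : S.Xe}
    (hpq : toFun p =ᵐ[volume.restrict S.Ωe] toFun q) : p = q := by
  obtain ⟨g, hg⟩ := h.exists_isGradient (p - q)
  have h0 : toFun (p - q) =ᵐ[volume.restrict S.Ωe] 0 := by
    filter_upwards [h.toFun_sub p q, hpq] with x h1 h2
    simp [h1, h2]
  have hg0 : g =ᵐ[volume.restrict S.Ωe] 0 :=
    (hg.admissible.weakGradient.congr h0 (.refl _ _)).ae_eq (isOpen_Ωe h.exterior)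
      HasWeakGradient.zero
  have e := Xe_enorm_sq (p - q) hg.represents
  have z1 : ∫⁻ x, ‖toFun (p - q) x‖ₑ ^ 2 ∂S.weighted S.weightFun = 0 := by
    rw [lintegral_congr_ae (g := 0)]
    · simp
    · filter_upwards [weighted_absolutelyContinuous _ h0] with x hx
      simp [hx]
  have z2 : ∫⁻ x, ‖radialPart x (g x)‖ₑ ^ 2 ∂S.weighted S.weightRad = 0 := by
    rw [lintegral_congr_ae (g := 0)]
    · simp
    · filter_upwards [weighted_absolutelyContinuous _ hg0] with x hx
      simp [hx]
  have z3 : ∫⁻ x, ‖tangentialPart x (g x)‖ₑ ^ 2 ∂S.weighted S.weightTan = 0 := by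
    rw [lintegral_congr_ae (g := 0)]
    · simp
    · filter_upwards [weighted_absolutelyContinuous _ hg0] with x hx
      simp [hx]
  rw [z1, z2, z3, add_zero, add_zero] at e
  simpa [sub_eq_zero] using e

end IsRegular

/-- The squared `H¹` norm over the shell, for the function `u` with gradient `g`. -/
noncomputable def shellEnergy (a b : ℝ) (u : E3 → ℂ) (g : E3 → C3) : ℝ≥0∞ :=
  (∫⁻ x in shell a b, ‖u x‖ₑ ^ 2) + ∫⁻ x in shell a b, ‖g x‖ₑ ^ 2

theorem lintegral_weighted_eq_setLIntegral (w : E3 → ℝ) {K : Set E3} (hK : MeasurableSet K)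
    {F : E3 → ℝ≥0∞} (hF : ∀ᵐ x ∂volume.restrict S.Ωe, x ∉ K → F x = 0) :
    ∫⁻ x, F x ∂S.weighted w = ∫⁻ x in K, F x ∂S.weighted w := by
  rw [← lintegral_add_compl F hK]
  have : ∫⁻ x in Kᶜ, F x ∂S.weighted w = 0 := by
    rw [setLIntegral_congr_fun_ae hK.compl (g := 0)]
    · simp
    · filter_upwards [weighted_absolutelyContinuous w hF] with x hx hxK
      exact hx hxK
  rw [this, add_zero]

namespace IsRegular

/-- On shells inside of `{r₁ < |x| < r₂}` the norm of `X_e` dominates the `H¹` norm. -/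
theorem exists_shellEnergy_le (h : S.IsRegular) {a b : ℝ} (ha : S.r₁ < a) (hb : b < S.r₂) :
    ∃ C : NNReal, ∀ (p : S.Xe) (g : E3 → C3), IsGradient p g →
      shellEnergy a b (toFun p) g ≤ C * ‖p‖ₑ ^ 2 := by
  obtain ⟨C, hC⟩ := h.exists_weight_bound ha hb
  have hsub := shell_subset_Ωe h.exterior ha hb
  have mK := measurableSet_shell a b
  have low : ∀ w ∈ ({S.weightFun, S.weightRad, S.weightTan} : Set (E3 → ℝ)), ∀ F : E3 → ℝ≥0∞,
      ∫⁻ x in shell a b, F x ≤ C * ∫⁻ x, F x ∂S.weighted w := fun w hw F =>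
    (setLIntegral_le_weighted mK hsub (fun x hx => (hC w hw x hx).2) F).trans
      (mul_le_mul_right (setLIntegral_le_lintegral _ _) _)
  refine ⟨2 * C, fun p g hg => ?_⟩
  rw [Xe_enorm_sq p hg.represents, shellEnergy]
  have e2 : ∫⁻ x in shell a b, ‖g x‖ₑ ^ 2 ≤
      2 * (∫⁻ x in shell a b, ‖radialPart x (g x)‖ₑ ^ 2) +
        2 * ∫⁻ x in shell a b, ‖tangentialPart x (g x)‖ₑ ^ 2 := by
    refine le_trans (le_of_eq ?_) (lintegral_enorm_add_sq_le
      (aestronglyMeasurable_radialPart hg.measurable.aestronglyMeasurable) _)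
    simp [tangentialPart_eq]
  calc _ ≤ C * (∫⁻ x, ‖toFun p x‖ₑ ^ 2 ∂S.weighted S.weightFun) +
        (2 * (C * ∫⁻ x, ‖radialPart x (g x)‖ₑ ^ 2 ∂S.weighted S.weightRad) +
          2 * (C * ∫⁻ x, ‖tangentialPart x (g x)‖ₑ ^ 2 ∂S.weighted S.weightTan)) := by
        exact add_le_add (low _ (by simp) _) (e2.trans (add_le_add
          (mul_le_mul_right (low _ (by simp) _) _) (mul_le_mul_right (low _ (by simp) _) _)))
    _ ≤ 2 * (C * (∫⁻ x, ‖toFun p x‖ₑ ^ 2 ∂S.weighted S.weightFun)) +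
        (2 * (C * ∫⁻ x, ‖radialPart x (g x)‖ₑ ^ 2 ∂S.weighted S.weightRad) +
          2 * (C * ∫⁻ x, ‖tangentialPart x (g x)‖ₑ ^ 2 ∂S.weighted S.weightTan)) := by
        exact add_le_add_left (le_mul_of_one_le_left' one_le_two) _
    _ = _ := by
        push_cast
        ring

/-- For functions supported in a shell inside of `{r₁ < |x| < r₂}` the `H¹` norm dominates the norm
of `X_e`. -/
theorem exists_enorm_sq_le_shellEnergy (h : S.IsRegular) {a b : ℝ} (ha : S.r₁ < a)
    (hb : b < S.r₂) :
    ∃ C : NNReal, ∀ (p : S.Xe) (g : E3 → C3), IsGradient p g →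
      (∀ᵐ x ∂volume.restrict S.Ωe, x ∉ shell a b → toFun p x = 0 ∧ g x = 0) →
      ‖p‖ₑ ^ 2 ≤ C * shellEnergy a b (toFun p) g := by
  obtain ⟨C, hC⟩ := h.exists_weight_bound ha hb
  have hsub := shell_subset_Ωe h.exterior ha hb
  have mK := measurableSet_shell a b
  refine ⟨5 * C, fun p g hg h0 => ?_⟩
  have up : ∀ w ∈ ({S.weightFun, S.weightRad, S.weightTan} : Set (E3 → ℝ)), ∀ F : E3 → ℝ≥0∞,
      (∀ᵐ x ∂volume.restrict S.Ωe, x ∉ shell a b → F x = 0) →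
      ∫⁻ x, F x ∂S.weighted w ≤ C * ∫⁻ x in shell a b, F x := fun w hw F hF =>
    (lintegral_weighted_eq_setLIntegral w mK hF).le.trans
      (setLIntegral_weighted_le mK hsub (fun x hx => (hC w hw x hx).1) F)
  rw [Xe_enorm_sq p hg.represents, shellEnergy]
  calc _ ≤ C * (∫⁻ x in shell a b, ‖toFun p x‖ₑ ^ 2) +
        (C * (∫⁻ x in shell a b, ‖radialPart x (g x)‖ₑ ^ 2) +
          C * ∫⁻ x in shell a b, ‖tangentialPart x (g x)‖ₑ ^ 2) := by
        refine add_le_add (up _ (by simp) _ ?_)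
          (add_le_add (up _ (by simp) _ ?_) (up _ (by simp) _ ?_))
        · filter_upwards [h0] with x hx hK
          simp [(hx hK).1]
        · filter_upwards [h0] with x hx hK
          simp [(hx hK).2]
        · filter_upwards [h0] with x hx hK
          simp [(hx hK).2]
    _ ≤ C * (5 * ∫⁻ x in shell a b, ‖toFun p x‖ₑ ^ 2) +
        (C * (∫⁻ x in shell a b, ‖g x‖ₑ ^ 2) +
          C * (4 * ∫⁻ x in shell a b, ‖g x‖ₑ ^ 2)) := by
        rw [← lintegral_const_mul' 4 _ (by simp)]
        gcongr with x x
        · exact le_mul_of_one_le_left' (by norm_num)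
        · exact enorm_radialPart_le _ _
        · exact enorm_tangentialPart_sq_le _ _
    _ = _ := by
        push_cast
        ring

end IsRegular

end Data

/-! ### Smooth multipliers that are constant off a shell -/

/-- `M` is smooth on `ℝ³`, with the value `c₁` on `{|x| ≤ a}` and the value `c₂` on `{b ≤ |x|}`. -/
structure IsTransition (a b : ℝ) (c₁ c₂ : ℂ) (M : E3 → ℂ) : Prop where
  contDiff : ContDiff ℝ (⊤ : ℕ∞) M
  eq_left : ∀ x, ‖x‖ ≤ a → M x = c₁
  eq_right : ∀ x, b ≤ ‖x‖ → M x = c₂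

/-- The smoothed symbol `ηε(|x|)` coincides on `B_{r₂}` with a smooth function on `ℝ³` that is
constant off a shell. It is smooth at `0`, as it is constant near `0`. -/
theorem exists_isTransition {r₁ r₂ ε : ℝ} (h1 : 0 < r₁) {η ηε : ℝ → ℂ}
    (hη : IsSmoothing r₁ r₂ ε η ηε) :
    ∃ (a b : ℝ) (c₁ c₂ : ℂ) (M : E3 → ℂ), r₁ < a ∧ b < r₂ ∧ IsTransition a b c₁ c₂ M ∧
      ∀ x : E3, ‖x‖ < r₂ → M x = ηε ‖x‖ := by
  obtain ⟨s, hs, hl⟩ := hη.eq_left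
  obtain ⟨s', hs', hr⟩ := hη.eq_right
  classical
  set c₂ := limUnder (𝓝[<] r₂) η
  set M : E3 → ℂ := fun x => if ‖x‖ < r₂ then ηε ‖x‖ else c₂ with hM
  have right : ∀ x : E3, s' ≤ ‖x‖ → M x = c₂ := by
    intro x hx
    by_cases h : ‖x‖ < r₂
    · simp only [hM, if_pos h, hr _ hx h]
    · simp only [hM, if_neg h]
  have left : ∀ x : E3, ‖x‖ ≤ s → M x = η r₁ := by
    intro x hx
    simp only [hM, if_pos (hx.trans_lt hs.2), hl _ (norm_nonneg x) hx]
  refine ⟨min s s', max s s', η r₁, c₂, M, lt_min hs.1 hs'.1, max_lt hs.2 hs'.2,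
    ⟨?_, fun x hx => left x (hx.trans (min_le_left _ _)),
      fun x hx => right x ((le_max_right _ _).trans hx)⟩, fun x hx => if_pos hx⟩
  refine contDiff_iff_contDiffAt.2 fun x => ?_
  rcases lt_or_ge ‖x‖ s with hx | hx
  · refine (contDiffAt_const (c := η r₁)).congr_of_eventuallyEq ?_
    filter_upwards [(isOpen_lt continuous_norm continuous_const).mem_nhds hx] with y hy
    exact left y (le_of_lt hy)
  rcases lt_or_ge s' ‖x‖ with hx' | hx'
  · refine (contDiffAt_const (c := c₂)).congr_of_eventuallyEq ?_
    filter_upwards [(isOpen_lt continuous_const continuous_norm).mem_nhds hx'] with y hy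
    exact right y (le_of_lt hy)
  have hm : ‖x‖ ∈ Ioo r₁ r₂ := ⟨hs.1.trans_le hx, hx'.trans_lt hs'.2⟩
  have hx0 : x ≠ 0 := norm_pos_iff.1 (h1.trans hm.1)
  have c := (hη.contDiffOn.contDiffAt (isOpen_Ioo.mem_nhds hm)).comp x (contDiffAt_norm ℝ hx0)
  refine c.congr_of_eventuallyEq ?_
  filter_upwards [(isOpen_lt continuous_norm continuous_const).mem_nhds hm.2] with y hy
  exact if_pos hy

theorem exists_bound_of_eq_const {F : Type*} [NormedAddCommGroup F] {f : E3 → F}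
    (hf : Continuous f) {b : ℝ} {c : F} (hc : ∀ x, b < ‖x‖ → f x = c) :
    ∃ B : NNReal, ∀ B' : NNReal, B ≤ B' → ∀ x, ‖f x‖ₑ ≤ B' := by
  obtain ⟨C, hC⟩ := (isCompact_closedBall (0 : E3) b).exists_bound_of_continuousOn hf.continuousOn
  refine ⟨C.toNNReal ⊔ ‖c‖₊, fun B' hB x => ?_⟩
  rw [enorm_eq_nnnorm]
  norm_cast
  refine le_trans ?_ hB
  rcases le_or_gt ‖x‖ b with h | h
  · refine le_sup_of_le_left ?_
    rw [← NNReal.coe_le_coe]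
    exact (hC x (by simpa using h)).trans (Real.le_coe_toNNReal C)
  · rw [hc x h]
    exact le_sup_right

/-- `B` bounds `M` and its derivatives of order at most two. -/
structure IsC2Bound (M : E3 → ℂ) (B : NNReal) : Prop where
  bound : ∀ x, ‖M x‖ₑ ≤ B
  fderiv_bound : ∀ x, ‖fderiv ℝ M x‖ₑ ≤ B
  partial_bound : ∀ (i : Fin 3) x, ‖fderiv ℝ M x (EuclideanSpace.single i 1)‖ₑ ≤ B
  gradient_bound : ∀ x, ‖classicalGradient M x‖ₑ ≤ B
  second_bound : ∀ (i : Fin 3) x,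
    ‖classicalGradient (fun y => fderiv ℝ M y (EuclideanSpace.single i 1)) x‖ₑ ≤ B

namespace IsTransition

variable {a b : ℝ} {c₁ c₂ : ℂ} {M : E3 → ℂ}

theorem eventuallyEq_right (hM : IsTransition a b c₁ c₂ M) {x : E3} (hx : b < ‖x‖) :
    M =ᶠ[𝓝 x] fun _ => c₂ := by
  filter_upwards [(isOpen_lt continuous_const continuous_norm).mem_nhds hx] with y hy
  exact hM.eq_right y (le_of_lt hy)

theorem eventuallyEq_left (hM : IsTransition a b c₁ c₂ M) {x : E3} (hx : ‖x‖ < a) :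
    M =ᶠ[𝓝 x] fun _ => c₁ := by
  filter_upwards [(isOpen_lt continuous_norm continuous_const).mem_nhds hx] with y hy
  exact hM.eq_left y (le_of_lt hy)

theorem classicalGradient_eq_zero (hM : IsTransition a b c₁ c₂ M) {x : E3} (hx : x ∉ shell a b) :
    classicalGradient M x = 0 := by
  have h0 : fderiv ℝ M x = 0 := by
    rcases lt_or_ge ‖x‖ a with h | h
    · rw [(hM.eventuallyEq_left h).fderiv_eq, fderiv_fun_const, Pi.zero_apply]
    · have : b < ‖x‖ := by
        by_contra hb
        exact hx ⟨h, not_lt.1 hb⟩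
      rw [(hM.eventuallyEq_right this).fderiv_eq, fderiv_fun_const, Pi.zero_apply]
  ext i
  simp [classicalGradient, h0]

theorem exists_isC2Bound (hM : IsTransition a b c₁ c₂ M) : ∃ B, IsC2Bound M B := by
  have hd : ∀ x, b < ‖x‖ → fderiv ℝ M x = 0 := fun x hx => by
    rw [(hM.eventuallyEq_right hx).fderiv_eq, fderiv_fun_const, Pi.zero_apply]
  have hd2 : ∀ (i : Fin 3) x, b < ‖x‖ →
      fderiv ℝ (fun y => fderiv ℝ M y (EuclideanSpace.single i 1)) x = 0 := fun i x hx => by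
    have : (fun y => fderiv ℝ M y (EuclideanSpace.single i 1)) =ᶠ[𝓝 x] fun _ => 0 := by
      filter_upwards [(isOpen_lt continuous_const continuous_norm).mem_nhds hx] with y hy
      rw [hd y hy]
      rfl
    rw [this.fderiv_eq, fderiv_fun_const, Pi.zero_apply]
  obtain ⟨B0, h0⟩ := exists_bound_of_eq_const hM.contDiff.continuous
    fun x hx => hM.eq_right x (le_of_lt hx)
  obtain ⟨B1, h1⟩ := exists_bound_of_eq_const (hM.contDiff.continuous_fderiv (by simp)) hd
  obtain ⟨B2, h2⟩ := exists_bound_of_eq_const (continuous_classicalGradient hM.contDiff) (b := b)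
    (c := 0) fun x hx => by
      ext i
      simp [classicalGradient, hd x hx]
  have h3 := fun i : Fin 3 => exists_bound_of_eq_const
    (contDiff_partial hM.contDiff (EuclideanSpace.single i 1)).continuous (b := b)
    (c := 0) fun x hx => by simp [hd x hx]
  have h4 := fun i : Fin 3 => exists_bound_of_eq_const
    (continuous_classicalGradient (contDiff_partial hM.contDiff (EuclideanSpace.single i 1)))
    (b := b) (c := 0) fun x hx => by
      ext j
      simp [classicalGradient, hd2 i x hx]
  choose B3 h3 using h3
  choose B4 h4 using h4
  refine ⟨B0 + B1 + B2 + ∑ i, B3 i + ∑ i, B4 i, h0 _ ?_, h1 _ ?_, fun i => h3 i _ ?_, h2 _ ?_,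
    fun i => h4 i _ ?_⟩
  · exact le_add_right (le_add_right (le_add_right le_self_add))
  · exact le_add_right (le_add_right (le_add_right le_add_self))
  · exact le_add_right (le_add_left (Finset.single_le_sum (fun _ _ => zero_le) (Finset.mem_univ i)))
  · exact le_add_right (le_add_right le_add_self)
  · exact le_add_left (Finset.single_le_sum (fun _ _ => zero_le) (Finset.mem_univ i))

end IsTransition

theorem IsC2Bound.enorm_sub_le {M : E3 → ℂ} {B : NNReal} (hB : IsC2Bound M B)
    (hM : ContDiff ℝ (⊤ : ℕ∞) M) (x y : E3) : ‖M x - M y‖ₑ ≤ B * ‖x - y‖ₑ := by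
  have hl : LipschitzWith B M := lipschitzWith_of_nnnorm_fderiv_le (hM.differentiable (by simp))
    fun x => by
      have := hB.fderiv_bound x
      rw [enorm_eq_nnnorm] at this
      exact_mod_cast this
  have := hl x y
  rwa [edist_eq_enorm_sub, edist_eq_enorm_sub] at this

namespace Data

variable {S : Data}

/-- Multiplication by `M` preserves `H¹_loc` and the boundary condition at `∂Ω`. -/
theorem IsAdmissible.mul (h : S.IsRegular) {a b : ℝ} {c₁ c₂ : ℂ} {M : E3 → ℂ}
    (hM : IsTransition a b c₁ c₂ M) (ha : S.r₁ < a) {u : E3 → ℂ} {g : E3 → C3}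
    (hu : S.IsAdmissible u g) :
    S.IsAdmissible (fun x => M x * u x) (fun x => M x • g x + u x • classicalGradient M x) where
  weakGradient := hu.weakGradient.mul (isOpen_Ωe h.exterior) hM.contDiff
  locL2_fun := by
    intro K hK hc
    obtain ⟨B, hB⟩ := hc.exists_bound_of_continuousOn hM.contDiff.continuous.continuousOn
    refine (hu.locL2_fun K hK hc).of_le_mul (c := B)
      (hM.contDiff.continuous.aestronglyMeasurable.mul (hu.locL2_fun K hK hc).1)
      ((ae_restrict_iff' hc.measurableSet).2 (.of_forall fun x hx => ?_))
    rw [norm_mul]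
    exact mul_le_mul_of_nonneg_right (hB x hx) (norm_nonneg _)
  locL2_grad := by
    intro K hK hc
    obtain ⟨B, hB⟩ := hc.exists_bound_of_continuousOn hM.contDiff.continuous.continuousOn
    obtain ⟨B', hB'⟩ := hc.exists_bound_of_continuousOn
      (continuous_classicalGradient hM.contDiff).continuousOn
    refine MemLp.add (f := fun x => M x • g x) (g := fun x => u x • classicalGradient M x) ?_ ?_
    · refine (hu.locL2_grad K hK hc).of_le_mul (c := B)
        (hM.contDiff.continuous.aestronglyMeasurable.smul (hu.locL2_grad K hK hc).1)
        ((ae_restrict_iff' hc.measurableSet).2 (.of_forall fun x hx => ?_))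
      rw [norm_smul]
      exact mul_le_mul_of_nonneg_right (hB x hx) (norm_nonneg _)
    · refine (hu.locL2_fun K hK hc).of_le_mul (c := B')
        ((hu.locL2_fun K hK hc).1.smul
          (continuous_classicalGradient hM.contDiff).aestronglyMeasurable)
        ((ae_restrict_iff' hc.measurableSet).2 (.of_forall fun x hx => ?_))
      rw [norm_smul, mul_comm]
      exact mul_le_mul_of_nonneg_right (hB' x hx) (norm_nonneg _)
  zero_trace := by
    -- near the boundary of `Ω` the multiplier is the constant `c₁`
    obtain ⟨φ, h1, h2, h3⟩ := (hu.smul c₁).zero_trace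
    have mA : MeasurableSet (S.Ωe ∩ Metric.ball 0 S.r₁) :=
      ((isOpen_Ωe h.exterior).inter Metric.isOpen_ball).measurableSet
    have hlt : ∀ x ∈ S.Ωe ∩ Metric.ball 0 S.r₁, ‖x‖ < a := fun x hx => by
      have := hx.2
      rw [mem_ball_zero_iff] at this
      exact this.trans ha
    refine ⟨φ, h1, ?_, ?_⟩
    · refine h2.congr fun k => eLpNorm_congr_ae
        ((ae_restrict_iff' mA).2 (.of_forall fun x hx => ?_))
      simp [hM.eq_left x (hlt x hx).le]
    · refine h3.congr fun k => eLpNorm_congr_ae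
        ((ae_restrict_iff' mA).2 (.of_forall fun x hx => ?_))
      have : x ∉ shell a b := fun hs => absurd hs.1 (not_le.2 (hlt x hx))
      simp [hM.eq_left x (hlt x hx).le, hM.classicalGradient_eq_zero this]

namespace IsRegular

/-- Multiplication by `M` maps `X_e` boundedly into itself: the term `u ∇M` of the gradient lives on
a shell on which the weights are comparable to constants. -/
theorem exists_mul (h : S.IsRegular) {a b : ℝ} {c₁ c₂ : ℂ} {M : E3 → ℂ}
    (hM : IsTransition a b c₁ c₂ M) (ha : S.r₁ < a) (hb : b < S.r₂) :
    ∃ C : NNReal, ∀ p : S.Xe, ∃ q : S.Xe,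
      toFun q =ᵐ[volume.restrict S.Ωe] (fun x => M x * toFun p x) ∧ ‖q‖ₑ ^ 2 ≤ C * ‖p‖ₑ ^ 2 := by
  obtain ⟨B, hB⟩ := hM.exists_isC2Bound
  obtain ⟨C, hC⟩ := h.exists_weight_bound ha hb
  have hsub := shell_subset_Ωe h.exterior ha hb
  have mK := measurableSet_shell a b
  refine ⟨11 * (1 + C * C) * B ^ 2, fun p => ?_⟩
  obtain ⟨g, hg⟩ := h.exists_isGradient p
  have ad := hg.admissible.mul h hM ha
  set N1 := ∫⁻ x, ‖toFun p x‖ₑ ^ 2 ∂S.weighted S.weightFun with hN1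
  set N2 := ∫⁻ x, ‖radialPart x (g x)‖ₑ ^ 2 ∂S.weighted S.weightRad with hN2
  set N3 := ∫⁻ x, ‖tangentialPart x (g x)‖ₑ ^ 2 ∂S.weighted S.weightTan with hN3
  have hE : ‖p‖ₑ ^ 2 = N1 + (N2 + N3) := Xe_enorm_sq p hg.represents
  have b1 : ∫⁻ x, ‖M x * toFun p x‖ₑ ^ 2 ∂S.weighted S.weightFun ≤ B ^ 2 * N1 := by
    rw [hN1, ← lintegral_const_mul' _ _ (by simp)]
    refine lintegral_mono fun x => ?_
    rw [enorm_mul, mul_pow]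
    gcongr
    exact hB.bound x
  -- the commutator term
  have com : ∀ w ∈ ({S.weightFun, S.weightRad, S.weightTan} : Set (E3 → ℝ)),
      ∫⁻ x, ‖toFun p x • classicalGradient M x‖ₑ ^ 2 ∂S.weighted w ≤ C * (C * (B ^ 2 * N1)) := by
    intro w hw
    rw [lintegral_weighted_eq_setLIntegral w mK (.of_forall fun x hx => by
      rw [hM.classicalGradient_eq_zero hx]; simp)]
    refine (setLIntegral_weighted_le mK hsub (fun x hx => (hC w hw x hx).1) _).trans ?_
    gcongr
    refine (setLIntegral_le_weighted (w := S.weightFun) mK hsub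
      (fun x hx => (hC _ (by simp) x hx).2) _).trans ?_
    gcongr
    refine (setLIntegral_le_lintegral _ _).trans ?_
    rw [hN1, ← lintegral_const_mul' _ _ (by simp)]
    refine lintegral_mono fun x => ?_
    rw [enorm_smul, mul_pow, mul_comm]
    gcongr
    exact hB.gradient_bound x
  have hmg : ∀ w, AEStronglyMeasurable (fun x => M x • g x) (S.weighted w) := fun w =>
    hM.contDiff.continuous.aestronglyMeasurable.smul hg.measurable.aestronglyMeasurable
  have b2 : ∫⁻ x, ‖radialPart x (M x • g x + toFun p x • classicalGradient M x)‖ₑ ^ 2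
      ∂S.weighted S.weightRad ≤ 2 * (B ^ 2 * N2) + 2 * (C * (C * (B ^ 2 * N1))) := by
    simp_rw [map_add]
    refine (lintegral_enorm_add_sq_le (aestronglyMeasurable_radialPart (hmg _)) _).trans ?_
    refine add_le_add (mul_le_mul_right ?_ _) (mul_le_mul_right ?_ _)
    · rw [hN2, ← lintegral_const_mul' _ _ (by simp)]
      refine lintegral_mono fun x => ?_
      rw [map_smul, enorm_smul, mul_pow]
      gcongr
      exact hB.bound x
    · refine le_trans (lintegral_mono fun x => ?_) (com _ (by simp))
      exact pow_le_pow_left' (enorm_radialPart_le _ _) 2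
  have b3 : ∫⁻ x, ‖tangentialPart x (M x • g x + toFun p x • classicalGradient M x)‖ₑ ^ 2
      ∂S.weighted S.weightTan ≤ 2 * (B ^ 2 * N3) + 2 * (4 * (C * (C * (B ^ 2 * N1)))) := by
    simp_rw [map_add]
    refine (lintegral_enorm_add_sq_le (aestronglyMeasurable_tangentialPart (hmg _)) _).trans ?_
    refine add_le_add (mul_le_mul_right ?_ _) (mul_le_mul_right ?_ _)
    · rw [hN3, ← lintegral_const_mul' _ _ (by simp)]
      refine lintegral_mono fun x => ?_
      rw [map_smul, enorm_smul, mul_pow]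
      gcongr
      exact hB.bound x
    · refine le_trans ?_ (mul_le_mul_right (com S.weightTan (by simp)) 4)
      rw [← lintegral_const_mul' 4 _ (by simp)]
      exact lintegral_mono fun x => enorm_tangentialPart_sq_le _ _
  have total := add_le_add b1 (add_le_add b2 b3)
  have hle : B ^ 2 * N1 + (2 * (B ^ 2 * N2) + 2 * (C * (C * (B ^ 2 * N1))) +
      (2 * (B ^ 2 * N3) + 2 * (4 * (C * (C * (B ^ 2 * N1)))))) ≤
      ((11 * (1 + C * C) * B ^ 2 : NNReal) : ℝ≥0∞) * ‖p‖ₑ ^ 2 := by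
    rw [hE]
    refine le_iff_exists_add.2 ⟨10 * B ^ 2 * N1 + 9 * B ^ 2 * (N2 + N3) +
      C * C * B ^ 2 * N1 + 11 * C * C * B ^ 2 * (N2 + N3), ?_⟩
    push_cast
    ring
  have total := total.trans hle
  have fin := total.trans_lt (ENNReal.mul_lt_top ENNReal.coe_lt_top (by simp))
  obtain ⟨q, hq⟩ := exists_of_isAdmissible ad (le_self_add.trans_lt fin)
    ((le_self_add.trans le_add_self).trans_lt fin) ((le_add_self.trans le_add_self).trans_lt fin)
  refine ⟨q, h.volume_absolutelyContinuous hq.fun_eq, ?_⟩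
  rw [Xe_enorm_sq q hq]
  exact total

theorem exists_isMultiplication (h : S.IsRegular) {a b : ℝ} {c₁ c₂ : ℂ} {M : E3 → ℂ}
    (hM : IsTransition a b c₁ c₂ M) (ha : S.r₁ < a) (hb : b < S.r₂) :
    ∃ T : S.Xe →L[ℂ] S.Xe, ∀ p : S.Xe,
      toFun (T p) =ᵐ[volume.restrict S.Ωe] fun x => M x * toFun p x := by
  obtain ⟨C, hC⟩ := h.exists_mul hM ha hb
  choose f hf hb using hC
  let T : S.Xe →ₗ[ℂ] S.Xe :=
    { toFun := f
      map_add' := fun p q => h.toFun_injective <| by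
        filter_upwards [hf (p + q), hf p, hf q, h.toFun_add p q, h.toFun_add (f p) (f q)]
          with x h1 h2 h3 h4 h5
        rw [h1, h4, h5, h2, h3]
        ring
      map_smul' := fun c p => h.toFun_injective <| by
        filter_upwards [hf (c • p), hf p, h.toFun_smul c p, h.toFun_smul c (f p)]
          with x h1 h2 h3 h4
        rw [RingHom.id_apply, h1, h4, h3, h2]
        ring }
  refine ⟨T.mkContinuous (Real.sqrt C) fun p => ?_, hf⟩
  have h1 := hb p
  rw [enorm_eq_nnnorm, enorm_eq_nnnorm] at h1
  have h2 : ‖f p‖ ^ 2 ≤ C * ‖p‖ ^ 2 := by exact_mod_cast h1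
  calc ‖f p‖ ≤ Real.sqrt (C * ‖p‖ ^ 2) := Real.le_sqrt_of_sq_le h2
    _ = Real.sqrt C * ‖p‖ := by rw [Real.sqrt_mul C.coe_nonneg, Real.sqrt_sq (norm_nonneg p)]

end IsRegular
end Data

/-! ### The local commutator estimate -/

theorem classicalGradient_sub_const (M : E3 → ℂ) (m : ℂ) :
    classicalGradient (fun x => M x - m) = classicalGradient M := by
  ext x i
  simp [classicalGradient, fderiv_sub_const]

/-- The `H¹` norm of `(M - M(x₀)) (u - c)` on a ball about `x₀` of radius `r ≤ 1`. -/
theorem sobolevSq_one_sub_mul_le {M : E3 → ℂ} {B : NNReal} (hM : ContDiff ℝ (⊤ : ℕ∞) M)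
    (hB : IsC2Bound M B) {x₀ : E3} {r : ℝ} (hr : r ≤ 1) {u : E3 → ℂ} {g : E3 → C3}
    (hg : HasWeakGradient (Metric.ball x₀ r) u g) (c : ℂ) :
    sobolevSq (Metric.ball x₀ r) 1 (fun x => (M x - M x₀) * (u x - c)) ≤
      B ^ 2 * (3 * (∫⁻ x in Metric.ball x₀ r, ‖u x - c‖ₑ ^ 2) +
        2 * (ENNReal.ofReal r ^ 2 * ∫⁻ x in Metric.ball x₀ r, ‖g x‖ₑ ^ 2)) := by
  set D := Metric.ball x₀ r with hD
  have oD : IsOpen D := Metric.isOpen_ball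
  have h1 := (hg.add (HasWeakGradient.const D (-c))).mul oD
    (hM.sub (contDiff_const (c := M x₀)))
  have e1 : sobolevSq D 1 (fun x => (M x - M x₀) * (u x - c)) =
      (∫⁻ x in D, ‖(M x - M x₀) * (u x - c)‖ₑ ^ 2) +
        ∫⁻ x in D, ‖(M x - M x₀) • g x + (u x - c) • classicalGradient M x‖ₑ ^ 2 := by
    have := sobolevSq_one_eq oD h1
    simpa only [Pi.add_apply, Pi.zero_apply, add_zero, ← sub_eq_add_neg,
      classicalGradient_sub_const] using this
  have small : ∀ x ∈ D, ‖M x - M x₀‖ₑ ≤ B * ENNReal.ofReal r := by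
    intro x hx
    refine (hB.enorm_sub_le hM x x₀).trans ?_
    gcongr
    rw [← ofReal_norm]
    exact ENNReal.ofReal_le_ofReal (mem_ball_iff_norm.1 hx).le
  have one : ENNReal.ofReal r ≤ 1 := ENNReal.ofReal_le_one.2 hr
  have i1 : ∫⁻ x in D, ‖(M x - M x₀) * (u x - c)‖ₑ ^ 2 ≤ B ^ 2 * ∫⁻ x in D, ‖u x - c‖ₑ ^ 2 := by
    rw [← lintegral_const_mul' _ _ (by simp)]
    refine setLIntegral_mono' oD.measurableSet fun x hx => ?_
    rw [enorm_mul, mul_pow]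
    gcongr
    exact (small x hx).trans (mul_le_of_le_one_right' one)
  have i2 : ∫⁻ x in D, ‖(M x - M x₀) • g x‖ₑ ^ 2 ≤
      B ^ 2 * (ENNReal.ofReal r ^ 2 * ∫⁻ x in D, ‖g x‖ₑ ^ 2) := by
    rw [← mul_assoc, ← mul_pow, ← lintegral_const_mul' _ _ (by finiteness)]
    refine setLIntegral_mono' oD.measurableSet fun x hx => ?_
    rw [enorm_smul, mul_pow]
    gcongr
    exact small x hx
  have i3 : ∫⁻ x in D, ‖(u x - c) • classicalGradient M x‖ₑ ^ 2 ≤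
      B ^ 2 * ∫⁻ x in D, ‖u x - c‖ₑ ^ 2 := by
    rw [← lintegral_const_mul' _ _ (by simp)]
    refine lintegral_mono fun x => ?_
    rw [enorm_smul, mul_pow, mul_comm]
    gcongr
    exact hB.gradient_bound x
  have mg : AEStronglyMeasurable (fun x => (M x - M x₀) • g x) (volume.restrict D) :=
    (hM.continuous.sub continuous_const).aestronglyMeasurable.smul
      hg.locInt_grad.aestronglyMeasurable
  rw [e1]
  refine (add_le_add i1 ((lintegral_enorm_add_sq_le mg _).trans
    (add_le_add (mul_le_mul_right i2 2) (mul_le_mul_right i3 2)))).trans (le_of_eq ?_)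
  ring

/-- The `H²` norm of `c (M - M(x₀))` on a ball about `x₀` of radius `r ≤ 1`. -/
theorem sobolevSq_two_const_mul_le {M : E3 → ℂ} {B : NNReal} (hM : ContDiff ℝ (⊤ : ℕ∞) M)
    (hB : IsC2Bound M B) {x₀ : E3} {r : ℝ} (hr : r ≤ 1) (c : ℂ) :
    sobolevSq (Metric.ball x₀ r) 2 (fun x => c * (M x - M x₀)) ≤
      7 * (B ^ 2 * ‖c‖ₑ ^ 2 * volume (Metric.ball x₀ r)) := by
  have hd : ∀ x v, fderiv ℝ (fun x => c * (M x - M x₀)) x v = c * fderiv ℝ M x v := by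
    intro x v
    have hx := hM.differentiable (by simp) x
    rw [fderiv_const_mul (hx.sub_const _), fderiv_sub_const]
    simp
  refine sobolevSq_two_le Metric.isOpen_ball (contDiff_const.mul (hM.sub contDiff_const))
    (fun x hx => ?_) (fun i x hx => ?_) fun i x hx => ?_
  · rw [enorm_mul, mul_pow, mul_comm]
    gcongr
    refine (hB.enorm_sub_le hM x x₀).trans (mul_le_of_le_one_right' ?_)
    rw [← ofReal_norm]
    exact ENNReal.ofReal_le_one.2 ((mem_ball_iff_norm.1 hx).le.trans hr)
  · rw [hd, enorm_mul, mul_pow, mul_comm]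
    gcongr
    exact hB.partial_bound i x
  · simp_rw [hd]
    have : classicalGradient (fun y => c * fderiv ℝ M y (EuclideanSpace.single i 1)) x =
        c • classicalGradient (fun y => fderiv ℝ M y (EuclideanSpace.single i 1)) x :=
      congrFun (classicalGradient_smul c (contDiff_partial hM _)) x
    rw [this, enorm_smul, mul_pow, mul_comm]
    gcongr
    exact hB.second_bound i x

namespace Data

variable {S : Data}

/-- The approximation estimate of `Q` on the balls of radii `ρ` and `R ρ` about `x₀`, with norms
squared; the case of an infinite right-hand side is included. -/
theorem sobolevSq_sub_le {Q : S.Xe → S.Xe} {C R ρ : ℝ} (hC : 0 < C) (hρ : 0 < ρ) {x₀ : E3} {s : ℕ}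
    {w : S.Xe} (hQ : MemSobolev (Metric.ball x₀ (R * ρ)) s (toFun w) →
      sobolevNorm (Metric.ball x₀ ρ) 1 (toFun (w - Q w)) ≤
        ENNReal.ofReal (C * ρ ^ (s - 1)) * sobolevNorm (Metric.ball x₀ (R * ρ)) s (toFun w)) :
    sobolevSq (Metric.ball x₀ ρ) 1 (toFun (w - Q w)) ≤
      ENNReal.ofReal (C * ρ ^ (s - 1)) ^ 2 * sobolevSq (Metric.ball x₀ (R * ρ)) s (toFun w) := by
  by_cases hs : MemSobolev (Metric.ball x₀ (R * ρ)) s (toFun w)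
  · have sq : ∀ a : ℝ≥0∞, (a ^ (1 / 2 : ℝ)) ^ 2 = a := fun a => by
      rw [← ENNReal.rpow_natCast, ← ENNReal.rpow_mul]
      norm_num
    have := pow_le_pow_left' (hQ hs) 2
    rwa [mul_pow, sobolevNorm, sobolevNorm, sq, sq] at this
  · rw [MemSobolev, not_lt, top_le_iff] at hs
    rw [hs, ENNReal.mul_top]
    · exact le_top
    · have : 0 < C * ρ ^ (s - 1) := by positivity
      simp [this]

namespace IsRegular

theorem sobolevSq_add_le (h : S.IsRegular) {D : Set E3} (hD : IsOpen D) (hsub : D ⊆ S.Ωe)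
    (p q : S.Xe) :
    sobolevSq D 1 (toFun (p + q)) ≤
      2 * sobolevSq D 1 (toFun p) + 2 * sobolevSq D 1 (toFun q) := by
  obtain ⟨g, hg⟩ := h.exists_isGradient p
  obtain ⟨k, hk⟩ := h.exists_isGradient q
  have wg := hg.admissible.weakGradient.mono hsub
  have wk := hk.admissible.weakGradient.mono hsub
  rw [sobolevSq_congr (ae_restrict_of_ae_restrict_of_subset hsub (h.toFun_add p q)) 1,
    sobolevSq_one_eq hD wg, sobolevSq_one_eq hD wk]
  refine (sobolevSq_one_eq hD (wg.add wk)).le.trans ?_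
  refine (add_le_add
    (lintegral_enorm_add_sq_le (stronglyMeasurable_toFun p).aestronglyMeasurable _)
    (lintegral_enorm_add_sq_le hg.measurable.aestronglyMeasurable _)).trans (le_of_eq ?_)
  ring

/-- The discrete commutator property on a single ball: `T u - Q (T u)` is unchanged if `M` is
replaced by `M - M(x₀)`, as `Q u = u`. In the splitting
`(M - M(x₀)) u = (M - M(x₀)) (u - c) + c (M - M(x₀))` the first term is small in `H¹` and the second
one is smooth. -/
theorem local_commutator_le (h : S.IsRegular) {M : E3 → ℂ} {B : NNReal}
    (hM : ContDiff ℝ (⊤ : ℕ∞) M) (hB : IsC2Bound M B) {T : S.Xe →L[ℂ] S.Xe}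
    (hT : ∀ p : S.Xe, toFun (T p) =ᵐ[volume.restrict S.Ωe] fun x => M x * toFun p x)
    {Q : S.Xe →L[ℂ] S.Xe} {C R ρ : ℝ} (hC : 0 < C) (hR : 1 < R) (hρ : 0 < ρ) (hRρ : R * ρ ≤ 1)
    {x₀ : E3} (hsub : Metric.ball x₀ (R * ρ) ⊆ S.Ωe)
    (hQ : ∀ s ∈ ({1, 2} : Set ℕ), ∀ w : S.Xe,
      MemSobolev (Metric.ball x₀ (R * ρ)) s (toFun w) →
      sobolevNorm (Metric.ball x₀ ρ) 1 (toFun (w - Q w)) ≤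
        ENNReal.ofReal (C * ρ ^ (s - 1)) * sobolevNorm (Metric.ball x₀ (R * ρ)) s (toFun w))
    {χ : S.Xe} (hχ : toFun χ =ᵐ[volume.restrict (Metric.ball x₀ (R * ρ))] fun _ => 1)
    {u : S.Xe} (hu : Q u = u) {g : E3 → C3} (hg : IsGradient u g) (c : ℂ) :
    sobolevSq (Metric.ball x₀ ρ) 1 (toFun (T u - Q (T u))) ≤
      14 * ENNReal.ofReal C ^ 2 * B ^ 2 *
        ((∫⁻ x in Metric.ball x₀ (R * ρ), ‖toFun u x - c‖ₑ ^ 2) +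
          ENNReal.ofReal (R * ρ) ^ 2 * ((∫⁻ x in Metric.ball x₀ (R * ρ), ‖g x‖ₑ ^ 2) +
            ‖c‖ₑ ^ 2 * volume (Metric.ball x₀ (R * ρ)))) := by
  have hle : ρ ≤ R * ρ := le_mul_of_one_le_left hρ.le hR.le
  have hsub' : Metric.ball x₀ ρ ⊆ S.Ωe := (Metric.ball_subset_ball hle).trans hsub
  set D := Metric.ball x₀ (R * ρ) with hD
  set m := M x₀ with hm
  set w1 : S.Xe := T (u - c • χ) - m • (u - c • χ) with hw1
  set w2 : S.Xe := c • (T χ - m • χ) with hw2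
  have dec : T u - Q (T u) = (w1 - Q w1) + (w2 - Q w2) := by
    have : w1 + w2 = T u - m • u := by
      rw [hw1, hw2, map_sub, map_smul, smul_sub, smul_sub, smul_comm m c χ]
      abel
    rw [show (w1 - Q w1) + (w2 - Q w2) = (w1 + w2) - Q (w1 + w2) by rw [map_add]; abel, this,
      map_sub, map_smul, hu]
    abel
  have onD : ∀ {f f' : E3 → ℂ}, f =ᵐ[volume.restrict S.Ωe] f' → f =ᵐ[volume.restrict D] f' :=
    fun H => ae_restrict_of_ae_restrict_of_subset hsub H
  have e1 : toFun w1 =ᵐ[volume.restrict D] fun x => (M x - M x₀) * (toFun u x - c) := by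
    filter_upwards [onD (h.toFun_sub (T (u - c • χ)) (m • (u - c • χ))), onD (hT (u - c • χ)),
      onD (h.toFun_smul m (u - c • χ)), onD (h.toFun_sub u (c • χ)), onD (h.toFun_smul c χ), hχ]
      with x a1 a2 a3 a4 a5 a6
    rw [a1, a2, a3, a4, a5, a6]
    ring
  have e2 : toFun w2 =ᵐ[volume.restrict D] fun x => c * (M x - M x₀) := by
    filter_upwards [onD (h.toFun_smul c (T χ - m • χ)), onD (h.toFun_sub (T χ) (m • χ)),
      onD (hT χ), onD (h.toFun_smul m χ), hχ] with x a1 a2 a3 a4 a5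
    rw [a1, a2, a3, a4, a5]
    ring
  have s1 := (sobolevSq_congr e1 1).le.trans
    (sobolevSq_one_sub_mul_le hM hB hRρ (hg.admissible.weakGradient.mono hsub) c)
  have s2 := (sobolevSq_congr e2 2).le.trans (sobolevSq_two_const_mul_le hM hB hRρ c)
  have q1 := sobolevSq_sub_le (Q := Q) hC hρ (hQ 1 (by simp) w1)
  have q2 := sobolevSq_sub_le (Q := Q) hC hρ (hQ 2 (by simp) w2)
  rw [show (1 - 1 : ℕ) = 0 from rfl, pow_zero, mul_one] at q1
  rw [show (2 - 1 : ℕ) = 1 from rfl, pow_one, ENNReal.ofReal_mul hC.le] at q2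
  have hρ' : ENNReal.ofReal ρ ≤ ENNReal.ofReal (R * ρ) := ENNReal.ofReal_le_ofReal hle
  rw [dec]
  refine (h.sobolevSq_add_le Metric.isOpen_ball hsub' _ _).trans ?_
  refine (add_le_add (mul_le_mul_right (q1.trans (mul_le_mul_right s1 _)) 2)
    (mul_le_mul_right (q2.trans (mul_le_mul' (pow_le_pow_left' (mul_le_mul_right hρ' _) 2) s2))
      2)).trans ?_
  set I1 := ∫⁻ x in D, ‖toFun u x - c‖ₑ ^ 2
  set I2 := ∫⁻ x in D, ‖g x‖ₑ ^ 2
  set r := ENNReal.ofReal (R * ρ)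
  refine le_iff_exists_add.2
    ⟨ENNReal.ofReal C ^ 2 * B ^ 2 * (8 * I1 + 10 * (r ^ 2 * I2)), ?_⟩
  ring

end IsRegular
end Data

/-! ### Averaging the local estimates -/

theorem measurable_setLIntegral_ball {G : E3 → E3 → ℝ≥0∞} (hG : Measurable (Function.uncurry G))
    (r : ℝ) : Measurable fun x => ∫⁻ y in Metric.ball x r, G x y := by
  simp_rw [fun x => setLIntegral_ball_eq (G x) x r]
  exact Measurable.lintegral_prod_right'
    (f := fun p : E3 × E3 => G p.1 (p.1 + p.2))
    (hG.comp (f := fun p : E3 × E3 => (p.1, p.1 + p.2)) (by fun_prop))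

namespace Data

variable {S : Data}

/-- The mean square of `u(y) - u(x)` over `|x - y| < r` is controlled by the gradient of `u`. -/
theorem IsGradient.lintegral_ball_sub_le (h : S.IsRegular) {u : S.Xe} {g : E3 → C3}
    (hg : IsGradient u g) {a b δ r : ℝ} (hδ : 0 < δ) (hr : r ≤ δ) (ha : S.r₁ < a - 2 * δ)
    (hb : b + 2 * δ < S.r₂) :
    ∫⁻ x in shell a b, ∫⁻ y in Metric.ball x r, ‖toFun u y - toFun u x‖ₑ ^ 2 ≤
      volume (Metric.ball (0 : E3) r) * (ENNReal.ofReal r ^ 2 *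
        ∫⁻ x in shell (a - 2 * δ) (b + 2 * δ), ‖g x‖ₑ ^ 2) := by
  have mu : Measurable (toFun u) := (stronglyMeasurable_toFun u).measurable
  rw [lintegral_setLIntegral_ball (G := fun x y => ‖toFun u y - toFun u x‖ₑ ^ 2)
    (((mu.comp measurable_snd).sub (mu.comp measurable_fst)).enorm.pow_const 2)]
  set K := shell (a - 2 * δ) (b + 2 * δ)
  refine (setLIntegral_mono' Metric.isOpen_ball.measurableSet
    (g := fun _ => ENNReal.ofReal r ^ 2 * ∫⁻ x in K, ‖g x‖ₑ ^ 2) fun t ht => ?_).trans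
    (by rw [setLIntegral_const, mul_comm])
  rw [mem_ball_zero_iff] at ht
  set U : Set E3 := {x | a - δ < ‖x‖ ∧ ‖x‖ < b + δ} with hU
  have oU : IsOpen U := (isOpen_lt continuous_const continuous_norm).inter
    (isOpen_lt continuous_norm continuous_const)
  have sub : shell a b ⊆ U := fun x hx => ⟨by linarith [hx.1], by linarith [hx.2]⟩
  refine (lintegral_mono_set sub).trans
    ((hg.admissible.weakGradient.lintegral_translate_sub_le hg.measurable (isCompact_shell _ _)
      (shell_subset_Ωe h.exterior ha hb) oU t fun x hx s hs => ?_).trans ?_)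
  · refine ball_subset_shell (a := a - δ) (b := b + δ) (δ := δ) (by linarith) (by linarith)
      ⟨hx.1.le, hx.2.le⟩ ?_
    rw [mem_ball_iff_norm, add_sub_cancel_left, norm_smul, Real.norm_of_nonneg hs.1]
    calc s * ‖t‖ ≤ 1 * ‖t‖ := mul_le_mul_of_nonneg_right hs.2 (norm_nonneg t)
      _ < δ := by linarith
  · gcongr
    rw [← ofReal_norm]
    exact ENNReal.ofReal_le_ofReal ht.le

/-- Local estimates on the balls about all points `x₀`, with the constant `c = u(x₀)`, average to an
estimate on a shell. -/
theorem shellEnergy_le_of_local (h : S.IsRegular) {u f : S.Xe} {g k : E3 → C3}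
    (hg : IsGradient u g) (hk : IsGradient f k) {a b δ ρ R : ℝ} (hδ : 0 < δ) (hR : 1 < R)
    (hρ : 0 < ρ) (hρδ : R * ρ ≤ δ) (ha : S.r₁ < a - 4 * δ) (hb : b + 4 * δ < S.r₂) {K : ℝ≥0∞}
    (hloc : ∀ x₀ ∈ shell (a - 2 * δ) (b + 2 * δ), sobolevSq (Metric.ball x₀ ρ) 1 (toFun f) ≤
      K * ((∫⁻ x in Metric.ball x₀ (R * ρ), ‖toFun u x - toFun u x₀‖ₑ ^ 2) +
          ENNReal.ofReal (R * ρ) ^ 2 * ((∫⁻ x in Metric.ball x₀ (R * ρ), ‖g x‖ₑ ^ 2) +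
            ‖toFun u x₀‖ₑ ^ 2 * volume (Metric.ball x₀ (R * ρ))))) (hK : K ≠ ⊤) :
    shellEnergy (a - δ) (b + δ) (toFun f) k ≤
      2 * K * ENNReal.ofReal (R ^ 3) * ENNReal.ofReal (R * ρ) ^ 2 *
        shellEnergy (a - 4 * δ) (b + 4 * δ) (toFun u) g := by
  have mu : Measurable (toFun u) := (stronglyMeasurable_toFun u).measurable
  have mf : Measurable fun x => ‖toFun f x‖ₑ ^ 2 :=
    (stronglyMeasurable_toFun f).measurable.enorm.pow_const 2
  have mg : Measurable fun x => ‖g x‖ₑ ^ 2 := hg.measurable.measurable.enorm.pow_const 2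
  have mk : Measurable fun x => ‖k x‖ₑ ^ 2 := hk.measurable.measurable.enorm.pow_const 2
  have hρδ' : ρ ≤ δ := (le_mul_of_one_le_left hρ.le hR.le).trans hρδ
  set A2 := shell (a - 2 * δ) (b + 2 * δ) with hA2
  set A4 := shell (a - 4 * δ) (b + 4 * δ) with hA4
  have mA2 : MeasurableSet A2 := measurableSet_shell _ _
  set r := R * ρ with hr
  set v := volume (Metric.ball (0 : E3) r) with hv
  set v' := volume (Metric.ball (0 : E3) ρ) with hv'
  have vol : ∀ x : E3, volume (Metric.ball x r) = v := fun x => Measure.addHaar_ball_center _ _ _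
  have vv : v = ENNReal.ofReal (R ^ 3) * v' := by
    rw [hv, hr, Measure.addHaar_ball_mul _ _ (by linarith)]
    simp [hv']
  set G := ∫⁻ x in A4, ‖g x‖ₑ ^ 2 with hG
  set N := ∫⁻ x in A4, ‖toFun u x‖ₑ ^ 2 with hN
  have sub24 : A2 ⊆ A4 := fun x hx => ⟨by linarith [hx.1], by linarith [hx.2]⟩
  have t1 : ∫⁻ x in A2, ∫⁻ y in Metric.ball x r, ‖toFun u y - toFun u x‖ₑ ^ 2 ≤
      v * (ENNReal.ofReal r ^ 2 * G) := by
    have := hg.lintegral_ball_sub_le h (a := a - 2 * δ) (b := b + 2 * δ) hδ hρδ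
      (by linarith) (by linarith)
    rwa [show a - 2 * δ - 2 * δ = a - 4 * δ by ring,
      show b + 2 * δ + 2 * δ = b + 4 * δ by ring] at this
  have t2 : ∫⁻ x in A2, ∫⁻ y in Metric.ball x r, ‖g y‖ₑ ^ 2 ≤ v * G :=
    lintegral_setLIntegral_ball_le mg mA2 fun x hx =>
      (Metric.ball_subset_ball hρδ).trans (ball_subset_shell (by linarith) (by linarith) hx)
  have t3 : ∫⁻ x in A2, ‖toFun u x‖ₑ ^ 2 * v ≤ v * N := by
    rw [lintegral_mul_const _ (mu.enorm.pow_const 2), mul_comm]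
    exact mul_le_mul_right (lintegral_mono_set sub24) _
  have upper : ∫⁻ x in A2, K * ((∫⁻ y in Metric.ball x r, ‖toFun u y - toFun u x‖ₑ ^ 2) +
      ENNReal.ofReal r ^ 2 * ((∫⁻ y in Metric.ball x r, ‖g y‖ₑ ^ 2) + ‖toFun u x‖ₑ ^ 2 * v)) ≤
      K * (v * (ENNReal.ofReal r ^ 2 * G) + ENNReal.ofReal r ^ 2 * (v * G + v * N)) := by
    rw [lintegral_const_mul' _ _ hK, lintegral_add_left, lintegral_const_mul' _ _ (by finiteness),
      lintegral_add_left]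
    · gcongr
    · exact measurable_setLIntegral_ball (G := fun _ y => ‖g y‖ₑ ^ 2) (mg.comp measurable_snd) r
    · exact measurable_setLIntegral_ball (G := fun x y => ‖toFun u y - toFun u x‖ₑ ^ 2)
        (((mu.comp measurable_snd).sub (mu.comp measurable_fst)).enorm.pow_const 2) r
  have lower : v' * shellEnergy (a - δ) (b + δ) (toFun f) k ≤
      ∫⁻ x in A2, ∫⁻ y in Metric.ball x ρ, (‖toFun f y‖ₑ ^ 2 + ‖k y‖ₑ ^ 2) := by
    rw [shellEnergy, ← lintegral_add_left mf]
    exact le_lintegral_setLIntegral_ball (mf.add mk) mA2 fun x hx =>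
      (Metric.ball_subset_ball hρδ').trans (ball_subset_shell (by linarith) (by linarith) hx)
  have mid : ∫⁻ x in A2, ∫⁻ y in Metric.ball x ρ, (‖toFun f y‖ₑ ^ 2 + ‖k y‖ₑ ^ 2) ≤
      ∫⁻ x in A2, K * ((∫⁻ y in Metric.ball x r, ‖toFun u y - toFun u x‖ₑ ^ 2) +
      ENNReal.ofReal r ^ 2 * ((∫⁻ y in Metric.ball x r, ‖g y‖ₑ ^ 2) + ‖toFun u x‖ₑ ^ 2 * v)) := by
    refine setLIntegral_mono' mA2 fun x hx => ?_
    have hsub : Metric.ball x ρ ⊆ S.Ωe := ((Metric.ball_subset_ball hρδ').trans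
      (ball_subset_shell (a' := a - 4 * δ) (b' := b + 4 * δ) (by linarith) (by linarith) hx)).trans
      (shell_subset_Ωe h.exterior ha hb)
    have := hloc x hx
    rw [sobolevSq_one_eq Metric.isOpen_ball (hk.admissible.weakGradient.mono hsub),
      ← lintegral_add_left mf, vol] at this
    exact this
  have all := lower.trans (mid.trans upper)
  have v0 : v' ≠ 0 := (Metric.measure_ball_pos volume 0 hρ).ne'
  have vt : v' ≠ ⊤ := measure_ball_lt_top.ne
  rw [← ENNReal.mul_le_mul_iff_right v0 vt]
  refine all.trans ?_
  rw [vv, shellEnergy, ← hG, ← hN]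
  refine le_iff_exists_add.2
    ⟨K * ENNReal.ofReal (R ^ 3) * v' * ENNReal.ofReal r ^ 2 * N, ?_⟩
  ring

/-! ### The discrete commutator property -/

/-- Off a neighbourhood of the shell on which `M` varies, `T u - Q (T u)` vanishes: there `M` is
locally a constant `c`, and `T u - Q (T u)` is unchanged if `M` is replaced by `M - c`. -/
theorem ae_eq_zero_of_notMem_shell (h : S.IsRegular) {a b : ℝ} {c₁ c₂ : ℂ} {M : E3 → ℂ}
    (hM : IsTransition a b c₁ c₂ M) {T : S.Xe →L[ℂ] S.Xe}
    (hT : ∀ p : S.Xe, toFun (T p) =ᵐ[volume.restrict S.Ωe] fun x => M x * toFun p x)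
    {Q : S.Xe →L[ℂ] S.Xe} {R ρ δ : ℝ} (hR : 1 < R) (hρ : 0 < ρ) (hρδ : R * ρ ≤ δ)
    (hQ : ∀ x₀ ∈ S.Ωe, ∀ w : S.Xe,
      toFun w =ᵐ[volume.restrict (Metric.ball x₀ (R * ρ) ∩ S.Ωe)] 0 →
        toFun (Q w) =ᵐ[volume.restrict (Metric.ball x₀ ρ ∩ S.Ωe)] 0)
    {u : S.Xe} (hu : Q u = u) :
    ∀ᵐ x ∂volume.restrict S.Ωe, x ∉ shell (a - δ) (b + δ) → toFun (T u - Q (T u)) x = 0 := by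
  have oΩ := isOpen_Ωe h.exterior
  have hle : ρ ≤ R * ρ := le_mul_of_one_le_left hρ.le hR.le
  set f := T u - Q (T u) with hf
  have loc : ∀ x₀ ∈ S.Ωe, ∀ c : ℂ, (∀ x ∈ Metric.ball x₀ (R * ρ), M x = c) →
      toFun f =ᵐ[volume.restrict (Metric.ball x₀ ρ ∩ S.Ωe)] 0 := by
    intro x₀ hx₀ c hc
    have sub : Metric.ball x₀ (R * ρ) ∩ S.Ωe ⊆ S.Ωe := inter_subset_right
    have mB : MeasurableSet (Metric.ball x₀ (R * ρ) ∩ S.Ωe) :=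
      (Metric.isOpen_ball.inter oΩ).measurableSet
    have w0 : toFun (T u - c • u) =ᵐ[volume.restrict (Metric.ball x₀ (R * ρ) ∩ S.Ωe)] 0 := by
      filter_upwards [ae_restrict_of_ae_restrict_of_subset sub (h.toFun_sub (T u) (c • u)),
        ae_restrict_of_ae_restrict_of_subset sub (h.toFun_smul c u),
        ae_restrict_of_ae_restrict_of_subset sub (hT u), ae_restrict_mem mB] with x h1 h2 h3 h4
      rw [h1, h2, h3, hc x h4.1, sub_self]
      rfl
    have q0 := hQ x₀ hx₀ _ w0
    have ef : f = (T u - c • u) - Q (T u - c • u) := by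
      rw [hf, map_sub, map_smul, hu]
      abel
    have sub' : Metric.ball x₀ ρ ∩ S.Ωe ⊆ Metric.ball x₀ (R * ρ) ∩ S.Ωe :=
      inter_subset_inter_left _ (Metric.ball_subset_ball hle)
    filter_upwards [q0, ae_restrict_of_ae_restrict_of_subset sub' w0,
      ae_restrict_of_ae_restrict_of_subset (sub'.trans sub)
        (h.toFun_sub (T u - c • u) (Q (T u - c • u)))] with x h1 h2 h3
    rw [ef, h3, h1, h2]
    simp
  rw [ae_restrict_iff' oΩ.measurableSet, ae_iff]
  refine measure_null_of_locally_null _ fun x₀ hx₀ => ?_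
  simp only [mem_ofPred_eq, Classical.not_imp] at hx₀
  obtain ⟨hΩ, hx, -⟩ := hx₀
  have z : toFun f =ᵐ[volume.restrict (Metric.ball x₀ ρ ∩ S.Ωe)] 0 := by
    rcases lt_or_ge ‖x₀‖ (a - δ) with hl | hl
    · refine loc x₀ hΩ c₁ fun x hx => hM.eq_left x ?_
      rw [mem_ball_iff_norm] at hx
      have := norm_sub_norm_le x x₀
      linarith
    · have hl' : b + δ < ‖x₀‖ := by
        by_contra hb
        exact hx ⟨hl, not_lt.1 hb⟩
      refine loc x₀ hΩ c₂ fun x hx => hM.eq_right x ?_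
      rw [mem_ball_iff_norm, norm_sub_rev] at hx
      have := norm_sub_norm_le x₀ x
      linarith
  refine ⟨_, inter_mem self_mem_nhdsWithin
    (mem_nhdsWithin_of_mem_nhds (Metric.ball_mem_nhds x₀ hρ)), ?_⟩
  rw [Filter.EventuallyEq, ae_restrict_iff' (Metric.isOpen_ball.inter oΩ).measurableSet,
    ae_iff] at z
  refine measure_mono_null (fun x hx => ?_) z
  simp only [mem_inter_iff, mem_ofPred_eq, Classical.not_imp] at hx ⊢
  exact ⟨⟨hx.2, hx.1.1⟩, hx.1.2.2⟩

/-- Off a closed set off which `p` vanishes, its gradient vanishes as well. -/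
theorem IsGradient.ae_eq_zero (h : S.IsRegular) {p : S.Xe} {g : E3 → C3} (hg : IsGradient p g)
    {K : Set E3} (hK : IsClosed K) (h0 : ∀ᵐ x ∂volume.restrict S.Ωe, x ∉ K → toFun p x = 0) :
    ∀ᵐ x ∂volume.restrict S.Ωe, x ∉ K → toFun p x = 0 ∧ g x = 0 := by
  have oΩ := isOpen_Ωe h.exterior
  have oV : IsOpen (S.Ωe ∩ Kᶜ) := oΩ.inter hK.isOpen_compl
  have z : toFun p =ᵐ[volume.restrict (S.Ωe ∩ Kᶜ)] 0 := by
    filter_upwards [ae_restrict_of_ae_restrict_of_subset inter_subset_left h0,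
      ae_restrict_mem oV.measurableSet] with x h1 h2
    exact h1 h2.2
  have zg : g =ᵐ[volume.restrict (S.Ωe ∩ Kᶜ)] 0 :=
    ((hg.admissible.weakGradient.mono inter_subset_left).congr z (.refl _ _)).ae_eq oV
      HasWeakGradient.zero
  rw [Filter.EventuallyEq, ae_restrict_iff' oV.measurableSet] at zg
  rw [ae_restrict_iff' oΩ.measurableSet] at h0 ⊢
  filter_upwards [h0, zg] with x h1 h2 hx hxK
  exact ⟨h1 hx hxK, h2 ⟨hx, hxK⟩⟩

/-- The discrete commutator property on a fixed scale `ρ`. -/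
theorem commutator_sq_le (h : S.IsRegular) {a b : ℝ} {c₁ c₂ : ℂ} {M : E3 → ℂ}
    (hM : IsTransition a b c₁ c₂ M) {δ : ℝ} (hδ : 0 < δ) (hδa : S.r₁ < a - 4 * δ)
    (hδb : b + 4 * δ < S.r₂) {B C1 C2 : NNReal} (hB : IsC2Bound M B)
    (hC1 : ∀ (p : S.Xe) (g : E3 → C3), IsGradient p g →
      (∀ᵐ x ∂volume.restrict S.Ωe, x ∉ shell (a - δ) (b + δ) → toFun p x = 0 ∧ g x = 0) →
      ‖p‖ₑ ^ 2 ≤ C1 * shellEnergy (a - δ) (b + δ) (toFun p) g)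
    (hC2 : ∀ (p : S.Xe) (g : E3 → C3), IsGradient p g →
      shellEnergy (a - 4 * δ) (b + 4 * δ) (toFun p) g ≤ C2 * ‖p‖ₑ ^ 2)
    {T : S.Xe →L[ℂ] S.Xe}
    (hT : ∀ p : S.Xe, toFun (T p) =ᵐ[volume.restrict S.Ωe] fun x => M x * toFun p x)
    {χ : S.Xe} (hχ : toFun χ =ᵐ[volume.restrict (shell (a - 4 * δ) (b + 4 * δ))] 1)
    {Q : S.Xe →L[ℂ] S.Xe} {C R ρ : ℝ} (hC : 1 < C) (hR : 1 < R) (hρ : 0 < ρ) (hρδ : R * ρ ≤ δ)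
    (hρ1 : R * ρ ≤ 1)
    (happ : ∀ s ∈ ({1, 2} : Set ℕ), ∀ x₀ ∈ S.Ωe, Metric.ball x₀ (R * ρ) ⊆ S.Ωe →
      ∀ w : S.Xe, MemSobolev (Metric.ball x₀ (R * ρ)) s (toFun w) →
      sobolevNorm (Metric.ball x₀ ρ) 1 (toFun (w - Q w)) ≤
        ENNReal.ofReal (C * ρ ^ (s - 1)) * sobolevNorm (Metric.ball x₀ (R * ρ)) s (toFun w))
    (hvan : ∀ x₀ ∈ S.Ωe, ∀ w : S.Xe,
      toFun w =ᵐ[volume.restrict (Metric.ball x₀ (R * ρ) ∩ S.Ωe)] 0 →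
        toFun (Q w) =ᵐ[volume.restrict (Metric.ball x₀ ρ ∩ S.Ωe)] 0)
    {u : S.Xe} (hu : Q u = u) :
    ‖T u - Q (T u)‖ₑ ^ 2 ≤ C1 * (2 * (14 * ENNReal.ofReal C ^ 2 * B ^ 2) *
      ENNReal.ofReal (R ^ 3) * ENNReal.ofReal (R * ρ) ^ 2 * (C2 * ‖u‖ₑ ^ 2)) := by
  have hsub := shell_subset_Ωe h.exterior hδa hδb
  obtain ⟨g, hg⟩ := h.exists_isGradient u
  obtain ⟨k, hk⟩ := h.exists_isGradient (T u - Q (T u))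
  have z := hk.ae_eq_zero h (isClosed_shell _ _)
    (ae_eq_zero_of_notMem_shell h hM hT hR hρ hρδ hvan hu)
  refine (hC1 _ k hk z).trans (mul_le_mul_right ?_ _)
  refine le_trans ?_ (mul_le_mul_right (hC2 u g hg) _)
  refine shellEnergy_le_of_local h hg hk hδ hR hρ hρδ hδa hδb (fun x₀ hx₀ => ?_) (by finiteness)
  have hball : Metric.ball x₀ (R * ρ) ⊆ shell (a - 4 * δ) (b + 4 * δ) :=
    (Metric.ball_subset_ball hρδ).trans (ball_subset_shell (by linarith) (by linarith) hx₀)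
  have hx₀' : x₀ ∈ S.Ωe := hsub ⟨by linarith [hx₀.1], by linarith [hx₀.2]⟩
  exact h.local_commutator_le hM.contDiff hB hT (by linarith) hR hρ hρ1 (hball.trans hsub)
    (fun s hs w hw => happ s hs x₀ hx₀' (hball.trans hsub) w hw)
    (ae_restrict_of_ae_restrict_of_subset hball hχ) hu hg (toFun u x₀)

/-- The discrete commutator property: `‖(1 - Qₙ) T uₙ‖ ≤ C hₙ ‖uₙ‖` for `uₙ` in the Galerkin space,
and large `n`. -/
theorem exists_discrete_commutator_le (h : S.IsRegular) {a b : ℝ} {c₁ c₂ : ℂ} {M : E3 → ℂ}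
    (hM : IsTransition a b c₁ c₂ M) (ha : S.r₁ < a) (hb : b < S.r₂)
    {T : S.Xe →L[ℂ] S.Xe}
    (hT : ∀ p : S.Xe, toFun (T p) =ᵐ[volume.restrict S.Ωe] fun x => M x * toFun p x)
    {Xh : ℕ → Submodule ℂ S.Xe} {ρ : ℕ → ℝ} {Q : ∀ n, S.Xe →L[ℂ] Xh n}
    (hQ : S.IsLocalProjection Xh ρ Q) (hconst : S.ContainsLocalConstants Xh) :
    ∃ C : NNReal, ∀ᶠ n in atTop, ∀ u ∈ Xh n,
      ‖T u - (Q n (T u) : S.Xe)‖ₑ ^ 2 ≤ C * ENNReal.ofReal (ρ n) ^ 2 * ‖u‖ₑ ^ 2 := by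
  obtain ⟨δ, hδ, hδa, hδb⟩ : ∃ δ : ℝ, 0 < δ ∧ S.r₁ < a - 4 * δ ∧ b + 4 * δ < S.r₂ := by
    refine ⟨min (a - S.r₁) (S.r₂ - b) / 5, ?_, ?_, ?_⟩
    · have := lt_min (sub_pos.2 ha) (sub_pos.2 hb)
      positivity
    · linarith [min_le_left (a - S.r₁) (S.r₂ - b)]
    · linarith [min_le_right (a - S.r₁) (S.r₂ - b)]
  obtain ⟨C, R, hC, hR, happ, hvan⟩ := hQ.local_estimate
  obtain ⟨B, hB⟩ := hM.exists_isC2Bound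
  obtain ⟨C1, hC1⟩ := h.exists_enorm_sq_le_shellEnergy (a := a - δ) (b := b + δ)
    (by linarith) (by linarith)
  obtain ⟨C2, hC2⟩ := h.exists_shellEnergy_le hδa hδb
  -- an element of `X_e` that is one near the shell, which serves as a cut-off function
  obtain ⟨n₀, hn₀⟩ := hconst _ (shell_subset_Ωe h.exterior hδa hδb) (isCompact_shell _ _)
  obtain ⟨χ, -, hχ⟩ := hn₀ (n₀ + 1) (Nat.lt_succ_self _)
  have ev : ∀ᶠ n in atTop, R * ρ n < min δ 1 := by
    have := hQ.tendsto_zero.const_mul R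
    rw [mul_zero] at this
    exact this.eventually (gt_mem_nhds (lt_min hδ one_pos))
  refine ⟨C1 * (2 * (14 * C.toNNReal ^ 2 * B ^ 2) * (R ^ 3).toNNReal * R.toNNReal ^ 2 * C2), ?_⟩
  filter_upwards [ev] with n hn u hu
  have key := commutator_sq_le h hM hδ hδa hδb hB hC1 hC2 hT hχ
    (Q := (Xh n).subtypeL ∘L Q n) hC hR (hQ.pos n) (hn.trans_le (min_le_left _ _)).le
    (hn.trans_le (min_le_right _ _)).le (happ n) (hvan n)
    (u := u) (congrArg Subtype.val (hQ.projection n ⟨u, hu⟩))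
  refine key.trans (le_of_eq ?_)
  rw [ENNReal.ofReal_mul (by linarith : (0 : ℝ) ≤ R)]
  simp only [ENNReal.ofReal]
  push_cast
  ring

end Data

/-! ### Operators on finite dimensional spaces -/

theorem isFredholmIndexZero_of_finiteDimensional {Y : Type*} [NormedAddCommGroup Y]
    [NormedSpace ℂ Y] [FiniteDimensional ℂ Y] (A : Y →L[ℂ] Y) : IsFredholmIndexZero A := by
  refine ⟨?_, ?_⟩
  · have fin : ∀ f : Y →ₗ[ℂ] Y, f.HasNoetherianRange := fun f =>
      LinearMap.HasNoetherianRange.of_isNoetherian_dom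
    exact ContinuousLinearMap.IsFredholm.of_isQuasiInverse (v := 0)
      ⟨LinearMap.FiniteRangeSetoid.equiv_iff_hasNoetherianRange.2 (fin _),
        LinearMap.FiniteRangeSetoid.equiv_iff_hasNoetherianRange.2 (fin _)⟩
  · have h1 := LinearMap.finrank_range_add_finrank_ker (A : Y →ₗ[ℂ] Y)
    have h2 := Submodule.finrank_quotient_add_finrank (A : Y →ₗ[ℂ] Y).range
    have : Module.finrank ℂ (A : Y →ₗ[ℂ] Y).ker = Module.finrank ℂ (Y ⧸ (A : Y →ₗ[ℂ] Y).range) := by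
      omega
    exact this

end ExactPML

open ExactPML
theorem theorem6p5 (S : Data) (hΩ : IsExteriorDomain S.Ω S.r₁) (hα : IsProfile S.r₁ S.tα)
    (hα' : IsAsymptoticProfile S.tα) (hr : IsDomainTransformation S.r₁ S.r₂ S.re)
    (Xh : ℕ → Submodule ℂ S.Xe) [∀ n, FiniteDimensional ℂ (Xh n)]
    (hproj : ∀ u : S.Xe, Tendsto (fun n => (Xh n).starProjection u) atTop (𝓝 u))
    (h : ℕ → ℝ) (Q : ∀ n, S.Xe →L[ℂ] Xh n) (hQ : S.IsLocalProjection Xh h Q)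
    (hconst : S.ContainsLocalConstants Xh)
    (ω : ℂ) (hω : ω ≠ 0) (ε : ℝ) (hε : 0 < ε) (ηε : ℝ → ℂ)
    (hη : IsSmoothing S.r₁ S.r₂ ε (S.symbol ω) ηε) :
    ∃ T : S.Xe →L[ℂ] S.Xe, S.IsMultiplication ηε T ∧
      (∀ n, IsFredholmIndexZero (compress (Xh n) (Q n) T)) ∧
      Tendsto (fun n => discreteNorm (Xh n) T (compress (Xh n) (Q n) T)) atTop (𝓝 0) := by
  have hS : S.IsRegular := ⟨hΩ, hα, hr⟩
  obtain ⟨a, b, c₁, c₂, M, ha, hb, hM, hMη⟩ := exists_isTransition hS.pos hη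
  obtain ⟨T, hT⟩ := hS.exists_isMultiplication hM ha hb
  refine ⟨T, fun u => ?_, fun n => isFredholmIndexZero_of_finiteDimensional _, ?_⟩
  · filter_upwards [hT u, ae_restrict_mem (Data.isOpen_Ωe hΩ).measurableSet] with x h1 h2
    rw [h1, hMη x (by simpa using h2.2)]
  · obtain ⟨C, hC⟩ := Data.exists_discrete_commutator_le hS hM ha hb hT hQ hconst
    have lim : Tendsto (fun n => Real.sqrt C * h n) atTop (𝓝 0) := by
      simpa using hQ.tendsto_zero.const_mul (Real.sqrt C)
    refine squeeze_zero' (.of_forall fun n => ?_) ?_ lim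
    · exact norm_nonneg (T ∘L (Xh n).subtypeL - (Xh n).subtypeL ∘L compress (Xh n) (Q n) T)
    filter_upwards [hC] with n hn
    have hpos := (hQ.pos n).le
    refine ContinuousLinearMap.opNorm_le_bound _ (by positivity) fun u => ?_
    have h1 := hn u u.2
    rw [ENNReal.ofReal, enorm_eq_nnnorm, enorm_eq_nnnorm] at h1
    have h2 : ‖T u - (Q n (T u) : S.Xe)‖₊ ^ 2 ≤ C * (h n).toNNReal ^ 2 * ‖(u : S.Xe)‖₊ ^ 2 := by
      exact_mod_cast h1
    have h3 : ‖T u - (Q n (T u) : S.Xe)‖ ^ 2 ≤ C * h n ^ 2 * ‖(u : S.Xe)‖ ^ 2 := by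
      have := NNReal.coe_le_coe.2 h2
      simpa [hpos] using this
    have h4 : C * h n ^ 2 * ‖(u : S.Xe)‖ ^ 2 = (Real.sqrt C * h n * ‖(u : S.Xe)‖) ^ 2 := by
      rw [mul_pow, mul_pow, Real.sq_sqrt C.coe_nonneg]
    rw [h4] at h3
    exact le_of_sq_le_sq h3 (by positivity)
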